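/- Let $\mathbb T=\mathbb R/2\pi\mathbb Z$ with the normalised measure $dx/2\pi$, which is used in all $L^p(\mathbb T)$ norms, and let $u(n)=\frac1{2\pi}\int_{\mathbb T}u(x)e^{-inx}\,dx$. Let $\bar\alpha=\frac{1+\sqrt{97}}{12}$, $\alpha\in(\bar\alpha,1]$, $\sigma\in\{1,-1\}$, and $$\zeta=\zeta(\alpha)=\min\Big(\frac13+\frac{2\alpha-1}{3(1-\alpha)},\ \frac{2\alpha(\alpha+1)}{4-4\alpha^2+3\alpha}\Big)>1,$$ where for $\alpha=1$ the first entry is read as $+\infty$ (so $\zeta(1)=\frac43$). Let $\gamma_\alpha$ be the law on $L^2(\mathbb T)=L^2(\mathbb T;\mathbb C)$ of the random series $\sum_{n\in\mathbb Z}g_n(1+|n|^{2\alpha})^{-1/2}e^{inx}$, where the $g_n$ are independent standard complex Gaussian variables (centred, with independent real and imaginary parts of variance $\frac12$). For $R>0$ let $\tilde\gamma_\alpha(A)=\gamma_\alpha(A\cap\{\|u\|_{L^2}\le R\})$ and $$\rho_\alpha(du)=e^{-\frac\sigma2\|u\|_{L^4}^4}\,\tilde\gamma_\alpha(du).$$ For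 $N\in\mathbb N$ let $\Phi^N_t:L^2(\mathbb T)\to L^2(\mathbb T)$, $t\in\mathbb R$, be the truncated Birkhoff flow: for $v(t)=\Phi^N_t(u)$ one has $v(0)=u$, the coefficients $v(t)(n)$ with $|n|>N$ are constant in $t$, and for $|n|\le N$ $$\frac{d}{dt}v(n)=\sum_{\substack{|j_1|,|j_2|,|j_3|\le N\\ j_1+j_2-j_3=n\\ |j_1|^{2\alpha}+|j_2|^{2\alpha}\ne|j_3|^{2\alpha}+|n|^{2\alpha}}}\frac{-\sigma}{|j_1|^{2\alpha}+|j_2|^{2\alpha}-|j_3|^{2\alpha}-|n|^{2\alpha}}\,v(j_1)v(j_2)\overline{v(j_3)}.$$ Then there is a constant $c>0$ (depending only on $\alpha,\sigma$) such that for all $R>0$ and $\varepsilon>0$ there is a constant $C(R,\varepsilon)>0$ (which may also depend on $\alpha,\sigma$) such that for all $N\in\mathbb N$, all $t\in\mathbb R$ and all Borel sets $A\subset L^2(\mathbb T)$ $$\rho_\alpha(\Phi^N_t(A))\le c\,\rho_\alpha(A)^{1-\varepsilon}\exp\Big(C(R,\varepsilon)\big(1+|t|^{\frac{\zeta}{\zeta-1}}\big)\Big),$$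 with the conventions $0^0=1$ and $0^{-a}=+\infty$ for $a>0$. -/

import Mathlib

open MeasureTheory ProbabilityTheory
open scoped ENNReal

noncomputable section

namespace BirkhoffGibbs

instance factTwoPiPos : Fact (0 < 2 * Real.pi) := ⟨Real.two_pi_pos⟩

/-- The circle `ℝ / 2πℤ`. -/
abbrev Torus : Type := AddCircle (2 * Real.pi)

/-- The space `L²(𝕋; ℂ)`, taken with respect to the normalised measure `dx / 2π`, so that
`‖u‖² = ∑ |u(n)|²` for the Fourier coefficients `u(n) = (2π)⁻¹ ∫ u(x) e^{-inx} dx`. -/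
abbrev L2 : Type := Lp ℂ 2 (@AddCircle.haarAddCircle (2 * Real.pi) _)

/-- `L²(𝕋)` carries its Borel `σ`-algebra. -/
instance measurableSpaceL2 : MeasurableSpace L2 := borel L2

instance borelSpaceL2 : BorelSpace L2 := ⟨rfl⟩

/-! ### The Gaussian and the Gibbs measure -/

/-- The law of a centred (circular) complex Gaussian variable `g` with `E|g|² = 1`: real and
imaginary part are independent real Gaussians of variance `1/2`. -/
def stdComplexGaussian : Measure ℂ :=
  ((gaussianReal 0 (1 / 2)).prod (gaussianReal 0 (1 / 2))).map
    Complex.measurableEquivRealProd.symm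

/-- The Fourier series `∑ₙ gₙ (1 + |n|^{2α})^{-1/2} e^{inx}`, as a sum in `L²(𝕋)`. -/
def fourierSeries (α : ℝ) (g : ℤ → ℂ) : L2 :=
  ∑' n : ℤ, (g n / (Real.sqrt (1 + |(n : ℝ)| ^ (2 * α)) : ℂ)) • fourierLp 2 n

/-- The Gaussian measure `γ_α` on `L²(𝕋)`: the law of the random Fourier series with independent
standard complex Gaussian coefficients `gₙ`, `n ∈ ℤ`. -/
def gaussian (α : ℝ) : Measure L2 :=
  (Measure.infinitePi (fun _ : ℤ => stdComplexGaussian)).map (fourierSeries α)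

/-- The restriction of `γ_α` to the ball `{‖u‖_{L²} ≤ R}`. -/
def gaussianBall (α R : ℝ) : Measure L2 :=
  (gaussian α).restrict {u | ‖u‖ ≤ R}

/-- `‖u‖_{L⁴}⁴` as an extended nonnegative number. -/
def L4pow (u : L2) : ℝ≥0∞ :=
  ∫⁻ x, ‖u x‖ₑ ^ 4 ∂AddCircle.haarAddCircle

/-- The Gibbs measure `ρ_α(du) = exp(-(σ/2) ‖u‖_{L⁴}⁴) γ̃_α(du)`, where `γ̃_α` is the restriction
of `γ_α` to the ball of radius `R`. -/
def gibbs (α σ R : ℝ) : Measure L2 :=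
  (gaussianBall α R).withDensity
    (fun u => EReal.exp (((-(σ / 2) : ℝ) : EReal) * (L4pow u : EReal)))

/-! ### The truncated Birkhoff flow -/

/-- The small divisor `|j₁|^{2α} + |j₂|^{2α} - |j₃|^{2α} - |n|^{2α}`. -/
def divisor (α : ℝ) (j₁ j₂ j₃ n : ℤ) : ℝ :=
  |(j₁ : ℝ)| ^ (2 * α) + |(j₂ : ℝ)| ^ (2 * α) - |(j₃ : ℝ)| ^ (2 * α) - |(n : ℝ)| ^ (2 * α)

/-- The frequencies `|n| ≤ N`. -/
def freq (N : ℕ) : Finset ℤ := Finset.Icc (-(N : ℤ)) N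

open Classical in
/-- The `n`-th Fourier coefficient of the Birkhoff vector field truncated at `N`. -/
def fieldCoeff (α σ : ℝ) (N : ℕ) (u : L2) (n : ℤ) : ℂ :=
  ∑ j ∈ (freq N ×ˢ freq N ×ˢ freq N).filter
      (fun j => j.1 + j.2.1 - j.2.2 = n ∧ divisor α j.1 j.2.1 j.2.2 n ≠ 0),
    ((-σ / divisor α j.1 j.2.1 j.2.2 n : ℝ) : ℂ) *
      fourierCoeff u j.1 * fourierCoeff u j.2.1 * starRingEnd ℂ (fourierCoeff u j.2.2)

/-- The truncated vector field `Π_N X(Π_N u)` on `L²(𝕋)`. It only involves the frequencies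
`|n| ≤ N`, so its flow leaves all other Fourier coefficients constant. -/
def field (α σ : ℝ) (N : ℕ) (u : L2) : L2 :=
  ∑ n ∈ freq N, fieldCoeff α σ N u n • fourierLp 2 n

/-- `v` is the global solution of the truncated Birkhoff equation with initial datum `u`. -/
def IsSolution (α σ : ℝ) (N : ℕ) (u : L2) (v : ℝ → L2) : Prop :=
  v 0 = u ∧ ∀ t : ℝ, HasDerivAt v (field α σ N (v t)) t

/-- The truncated Birkhoff flow `Φ^N_t(u)`, the value at time `t` of the (unique) global solution
issued from `u`. -/
def flow (α σ : ℝ) (N : ℕ) (t : ℝ) (u : L2) : L2 :=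
  Classical.epsilon (IsSolution α σ N u) t

/-! ### The exponents -/

/-- The lower bound `(1 + √97) / 12` for the dispersion exponent. -/
def alphaBar : ℝ := (1 + Real.sqrt 97) / 12

/-- The exponent `ζ(α) = min (1/3 + (2α-1)/(3(1-α))) (2α(α+1)/(4-4α²+3α))`. At `α = 1` the first
entry of the minimum is `+∞`, so that the minimum is the second one. -/
def zeta (α : ℝ) : ℝ :=
  if α = 1 then 2 * α * (α + 1) / (4 - 4 * α ^ 2 + 3 * α)
  else min (1 / 3 + (2 * α - 1) / (3 * (1 - α))) (2 * α * (α + 1) / (4 - 4 * α ^ 2 + 3 * α))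

end BirkhoffGibbs

end

noncomputable section

namespace BirkhoffGibbs

/-! ### Flows of vector fields tangent to spheres -/

section Flow

open Set Metric
open scoped NNReal Topology RealInnerProductSpace

theorem exists_global_solution_of_lipschitz_of_bounded {F : Type*} [NormedAddCommGroup F]
    [NormedSpace ℝ F] [CompleteSpace F] {f : F → F} {K L : ℝ≥0} (hf : LipschitzWith K f)
    (hb : ∀ x, ‖f x‖ ≤ L) (x : F) :
    ∃ γ : ℝ → F, γ 0 = x ∧ ∀ t, HasDerivAt γ (f (γ t)) t := by
  have key : ∀ n : ℕ, ∃ α : ℝ → F, α 0 = x ∧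
      ∀ t ∈ Ioo (-(n + 1 : ℝ)) (n + 1), HasDerivAt α (f (α t)) t := by
    intro n
    have h0 : (0 : ℝ) ∈ Icc (-(n + 1 : ℝ)) (n + 1) := ⟨by linarith [n.cast_nonneg (α := ℝ)], by positivity⟩
    have hp : IsPicardLindelof (fun _ : ℝ => f) (tmin := -(n + 1 : ℝ)) (tmax := n + 1) ⟨0, h0⟩ x
        (L * (n + 1)) 0 L K := by
      apply IsPicardLindelof.of_time_independent (fun y _ => hb y) hf.lipschitzOnWith
      simp
    obtain ⟨α, h1, h2⟩ := hp.exists_eq_forall_mem_Icc_hasDerivWithinAt₀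
    exact ⟨α, h1, fun t ht => (h2 t (Ioo_subset_Icc_self ht)).hasDerivAt (Icc_mem_nhds ht.1 ht.2)⟩
  choose α hα0 hα using key
  have huniq : ∀ m n : ℕ, m ≤ n → EqOn (α m) (α n) (Ioo (-(m + 1 : ℝ)) (m + 1)) := by
    intro m n hmn
    have hmn' : (m : ℝ) ≤ n := by exact_mod_cast hmn
    apply ODE_solution_unique_of_mem_Ioo (v := fun _ => f) (s := fun _ => univ) (K := K) (t₀ := 0)
      (fun _ _ => hf.lipschitzOnWith)
      ⟨by linarith [m.cast_nonneg (α := ℝ)], by positivity⟩ (fun t ht => ⟨hα m t ht, mem_univ _⟩)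
      (fun t ht => ⟨hα n t ⟨by linarith [ht.1], by linarith [ht.2]⟩, mem_univ _⟩)
    rw [hα0, hα0]
  have hmem : ∀ t : ℝ, t ∈ Ioo (-((⌈|t|⌉₊ : ℝ) + 1)) ((⌈|t|⌉₊ : ℝ) + 1) := by
    intro t
    exact abs_lt.1 (by linarith [Nat.le_ceil |t|])
  have heq : ∀ n : ℕ, ∀ t ∈ Ioo (-(n + 1 : ℝ)) (n + 1), α ⌈|t|⌉₊ t = α n t := by
    intro n t ht
    rcases le_total ⌈|t|⌉₊ n with h | h
    · exact huniq _ _ h (hmem t)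
    · exact (huniq _ _ h ht).symm
  refine ⟨fun t => α ⌈|t|⌉₊ t, by simp [hα0], fun t => ?_⟩
  refine (hα _ t (hmem t)).congr_of_eventuallyEq ?_
  filter_upwards [Ioo_mem_nhds (hmem t).1 (hmem t).2] with s hs using heq _ s hs

variable {E : Type*} [NormedAddCommGroup E] [InnerProductSpace ℝ E]

theorem norm_eq_of_hasDerivAt_of_inner_eq_zero {X : E → E} (hX : ∀ x, ⟪x, X x⟫ = 0)
    {γ : ℝ → E} (hγ : ∀ t, HasDerivAt γ (X (γ t)) t) (t : ℝ) : ‖γ t‖ = ‖γ 0‖ := by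
  have h : ∀ s, HasDerivAt (fun s => ‖γ s‖ ^ 2) 0 s := fun s => by
    simpa [hX] using (hγ s).norm_sq
  have := is_const_of_deriv_eq_zero (fun s => (h s).differentiableAt) (fun s => (h s).deriv) t 0
  exact (sq_eq_sq₀ (norm_nonneg _) (norm_nonneg _)).1 this

/-- `φ` is the global flow of the vector field `X`. -/
structure IsFlow (X : E → E) (φ : ℝ → E → E) : Prop where
  zero : ∀ x, φ 0 x = x
  deriv : ∀ x t, HasDerivAt (fun s => φ s x) (X (φ t x)) t

namespace IsFlow

variable {X : E → E} {φ : ℝ → E → E}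

theorem norm_eq (h : IsFlow X φ) (hi : ∀ x, ⟪x, X x⟫ = 0) (t : ℝ) (x : E) : ‖φ t x‖ = ‖x‖ := by
  rw [norm_eq_of_hasDerivAt_of_inner_eq_zero hi (h.deriv x) t, h.zero]

theorem neg (h : IsFlow X φ) : IsFlow (fun x => -X x) (fun t => φ (-t)) := by
  refine ⟨fun x => by simp [h.zero], fun x t => ?_⟩
  simpa [Function.comp_def] using (h.deriv x (-t)).scomp t (hasDerivAt_neg t)

theorem dist_le (h : IsFlow X φ) (hi : ∀ x, ⟪x, X x⟫ = 0) {r : ℝ} {K : ℝ≥0}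
    (hK : LipschitzOnWith K X (closedBall 0 r)) {x y : E} (hx : ‖x‖ ≤ r) (hy : ‖y‖ ≤ r) {t : ℝ}
    (ht : 0 ≤ t) : dist (φ t x) (φ t y) ≤ dist x y * Real.exp (K * t) := by
  have := dist_le_of_trajectories_ODE_of_mem (v := fun _ => X) (s := fun _ => closedBall 0 r)
    (a := 0) (b := t) (K := K) (f := fun s => φ s x) (g := fun s => φ s y) (δ := dist x y)
    (fun _ _ => hK) (fun s _ => (h.deriv x s).continuousAt.continuousWithinAt)
    (fun s _ => (h.deriv x s).hasDerivWithinAt)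
    (fun s _ => by rw [mem_closedBall_zero_iff, h.norm_eq hi]; exact hx)
    (fun s _ => (h.deriv y s).continuousAt.continuousWithinAt)
    (fun s _ => (h.deriv y s).hasDerivWithinAt)
    (fun s _ => by rw [mem_closedBall_zero_iff, h.norm_eq hi]; exact hy)
    (by rw [h.zero, h.zero]) t ⟨ht, le_rfl⟩
  simpa using this

end IsFlow

variable [FiniteDimensional ℝ E]

theorem exists_lipschitzOnWith_closedBall {F : Type*} [NormedAddCommGroup F] [NormedSpace ℝ F]
    {X : E → F} (hX : ContDiff ℝ 1 X) (r : ℝ) :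
    ∃ K : ℝ≥0, LipschitzOnWith K X (closedBall 0 r) := by
  have hc : IsCompact (closedBall (0 : E) r) := isCompact_closedBall _ _
  obtain ⟨K, hK⟩ := hc.exists_bound_of_continuousOn (hX.continuous_fderiv one_ne_zero).continuousOn
  refine ⟨K.toNNReal, (convex_closedBall _ _).lipschitzOnWith_of_nnnorm_fderiv_le
    (fun x _ => hX.differentiable one_ne_zero x) fun x hx => ?_⟩
  rw [← NNReal.coe_le_coe, coe_nnnorm]
  exact (hK x hx).trans (Real.le_coe_toNNReal K)

theorem exists_global_solution_of_inner_eq_zero {X : E → E} (hX : ContDiff ℝ 1 X)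
    (hi : ∀ x, ⟪x, X x⟫ = 0) (x : E) :
    ∃ γ : ℝ → E, γ 0 = x ∧ ∀ t, HasDerivAt γ (X (γ t)) t := by
  let χ : ContDiffBump (0 : E) := ⟨‖x‖ + 1, ‖x‖ + 2, by positivity, by linarith⟩
  have hY : ContDiff ℝ 1 (fun y => χ y • X y) := χ.contDiff.smul hX
  have hcs : HasCompactSupport (fun y => χ y • X y) := χ.hasCompactSupport.smul_right
  obtain ⟨K, hK⟩ := hY.lipschitzWith_of_hasCompactSupport hcs one_ne_zero
  obtain ⟨L, hL⟩ := hY.continuous.bounded_above_of_compact_support hcs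
  obtain ⟨γ, h0, hγ⟩ := exists_global_solution_of_lipschitz_of_bounded hK (L := L.toNNReal)
    (fun y => (hL y).trans (Real.le_coe_toNNReal L)) x
  have hn := norm_eq_of_hasDerivAt_of_inner_eq_zero (X := fun y => χ y • X y)
    (fun y => by rw [inner_smul_right, hi, mul_zero]) hγ
  refine ⟨γ, h0, fun t => ?_⟩
  have h1 : χ (γ t) = 1 := by
    apply χ.one_of_mem_closedBall
    rw [mem_closedBall_zero_iff, hn t, h0]
    change ‖x‖ ≤ ‖x‖ + 1
    linarith
  simpa [h1] using hγ t

theorem exists_isFlow {X : E → E} (hX : ContDiff ℝ 1 X) (hi : ∀ x, ⟪x, X x⟫ = 0) :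
    ∃ φ, IsFlow X φ := by
  choose γ h0 hγ using exists_global_solution_of_inner_eq_zero hX hi
  exact ⟨fun t x => γ x t, h0, hγ⟩

theorem solution_unique {X : E → E} (hX : ContDiff ℝ 1 X) (hi : ∀ x, ⟪x, X x⟫ = 0)
    {γ δ : ℝ → E} (hγ : ∀ t, HasDerivAt γ (X (γ t)) t) (hδ : ∀ t, HasDerivAt δ (X (δ t)) t)
    (h0 : γ 0 = δ 0) : γ = δ := by
  obtain ⟨K, hK⟩ := exists_lipschitzOnWith_closedBall hX ‖γ 0‖
  refine ODE_solution_unique_univ (v := fun _ => X) (s := fun _ => closedBall 0 ‖γ 0‖) (K := K)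
    (t₀ := 0) (fun _ => hK) (fun t => ⟨hγ t, ?_⟩) (fun t => ⟨hδ t, ?_⟩) h0
  · rw [mem_closedBall_zero_iff, norm_eq_of_hasDerivAt_of_inner_eq_zero hi hγ t]
  · rw [mem_closedBall_zero_iff, norm_eq_of_hasDerivAt_of_inner_eq_zero hi hδ t, h0]

namespace IsFlow

variable {X : E → E} {φ : ℝ → E → E}

theorem add (h : IsFlow X φ) (hX : ContDiff ℝ 1 X) (hi : ∀ x, ⟪x, X x⟫ = 0) (s t : ℝ) (x : E) :
    φ (s + t) x = φ s (φ t x) := by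
  have := solution_unique hX hi (γ := fun s => φ (s + t) x) (δ := fun s => φ s (φ t x))
    (fun s => (h.deriv x (s + t)).comp_add_const s t) (h.deriv _) (by simp [h.zero])
  exact congrFun this s

theorem neg_comp (h : IsFlow X φ) (hX : ContDiff ℝ 1 X) (hi : ∀ x, ⟪x, X x⟫ = 0) (t : ℝ) (x : E) :
    φ (-t) (φ t x) = x := by
  rw [← h.add hX hi, neg_add_cancel, h.zero]

theorem continuous_of_nonneg (h : IsFlow X φ) (hX : ContDiff ℝ 1 X) (hi : ∀ x, ⟪x, X x⟫ = 0)
    {t : ℝ} (ht : 0 ≤ t) : Continuous (φ t) := by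
  refine continuous_iff_continuousAt.2 fun x => ?_
  obtain ⟨K, hK⟩ := exists_lipschitzOnWith_closedBall hX (‖x‖ + 1)
  have hL : LipschitzOnWith (Real.toNNReal (Real.exp (K * t))) (φ t) (closedBall 0 (‖x‖ + 1)) := by
    refine LipschitzOnWith.of_dist_le_mul fun y hy z hz => ?_
    rw [Real.coe_toNNReal _ (Real.exp_pos _).le, mul_comm]
    exact h.dist_le hi hK (mem_closedBall_zero_iff.1 hy) (mem_closedBall_zero_iff.1 hz) ht
  refine hL.continuousOn.continuousAt (closedBall_mem_nhds_of_mem ?_)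
  simp

theorem continuous (h : IsFlow X φ) (hX : ContDiff ℝ 1 X) (hi : ∀ x, ⟪x, X x⟫ = 0) (t : ℝ) :
    Continuous (φ t) := by
  rcases le_total 0 t with ht | ht
  · exact h.continuous_of_nonneg hX hi ht
  · simpa using h.neg.continuous_of_nonneg hX.neg (fun x => by simp [hi]) (neg_nonneg.2 ht)

end IsFlow

end Flow

/-! ### Liouville's theorem -/

section Liouville

open Set Metric
open scoped NNReal Topology RealInnerProductSpace

theorem hausdorffMeasure_image_le_of_dist_le {α E F : Type*} [MetricSpace E] [MeasurableSpace E]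
    [BorelSpace E] [MetricSpace F] [MeasurableSpace F] [BorelSpace F] {f : α → F} {g : α → E}
    {B : Set α} {K : ℝ≥0} (h : ∀ x ∈ B, ∀ y ∈ B, dist (f x) (f y) ≤ K * dist (g x) (g y))
    {d : ℝ} (hd : 0 ≤ d) :
    Measure.hausdorffMeasure d (f '' B) ≤ (K : ℝ≥0∞) ^ d * Measure.hausdorffMeasure d (g '' B) := by
  rcases B.eq_empty_or_nonempty with rfl | hB
  · simp
  have : Nonempty α := ⟨hB.some⟩
  have hL : LipschitzOnWith K (fun p => f (Function.invFunOn g B p)) (g '' B) := by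
    refine LipschitzOnWith.of_dist_le_mul fun p hp q hq => ?_
    refine (h _ (Function.invFunOn_mem hp) _ (Function.invFunOn_mem hq)).trans_eq ?_
    rw [Function.invFunOn_eq hp, Function.invFunOn_eq hq]
  have himg : f '' B ⊆ (fun p => f (Function.invFunOn g B p)) '' (g '' B) := by
    rintro _ ⟨x, hx, rfl⟩
    refine ⟨g x, mem_image_of_mem g hx, ?_⟩
    have hp : g x ∈ g '' B := mem_image_of_mem g hx
    have := h _ (Function.invFunOn_mem hp) x hx
    rw [Function.invFunOn_eq hp, dist_self, mul_zero] at this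
    exact dist_le_zero.1 this
  exact (measure_mono himg).trans (hL.hausdorffMeasure_image_le hd)

variable {E : Type*} [NormedAddCommGroup E] [NormedSpace ℝ E] [FiniteDimensional ℝ E]

theorem differentiable_det : Differentiable ℝ (fun A : E →L[ℝ] E => A.det) := by
  let b := Module.finBasis ℝ E
  have h : (fun A : E →L[ℝ] E => A.det) = fun A : E →L[ℝ] E =>
      ∑ σ : Equiv.Perm (Fin (Module.finrank ℝ E)), Equiv.Perm.sign σ •
        ∏ i, b.repr (A (b i)) (σ i) := by
    ext A
    rw [ContinuousLinearMap.det, ← LinearMap.det_toMatrix b, Matrix.det_apply]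
    simp [LinearMap.toMatrix_apply]
  rw [h]
  have hent : ∀ i j, ContDiff ℝ 1 fun A : E →L[ℝ] E => b.repr (A (b i)) j := fun i j => by
    let l : (E →L[ℝ] E) →ₗ[ℝ] ℝ :=
      (b.coord j).comp ((ContinuousLinearMap.apply ℝ E (b i)).toLinearMap)
    exact (LinearMap.toContinuousLinearMap l).contDiff
  refine ContDiff.differentiable (n := 1) ?_ one_ne_zero
  refine ContDiff.sum fun σ _ => ?_
  have : ContDiff ℝ 1 fun A : E →L[ℝ] E => ∏ i, b.repr (A (b i)) (σ i) :=
    contDiff_prod fun i _ => hent i (σ i)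
  exact this.const_smul _

theorem hasDerivAt_det_one_add_smul (A : E →L[ℝ] E) :
    HasDerivAt (fun h : ℝ => (1 + h • A).det) (LinearMap.trace ℝ E A) 0 := by
  let b := Module.finBasis ℝ E
  let M := LinearMap.toMatrix b b (A : E →ₗ[ℝ] E)
  have h : (fun h : ℝ => (1 + h • A).det) = fun h : ℝ => 1 + M.trace * h +
      (Matrix.det (1 + (Polynomial.X : Polynomial ℝ) • M.map Polynomial.C)).divX.divX.eval h
        * h ^ 2 := by
    ext h
    rw [← Matrix.det_one_add_smul, ContinuousLinearMap.det, ← LinearMap.det_toMatrix b]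
    congr 1
    have : ((1 + h • A : E →L[ℝ] E) : E →ₗ[ℝ] E) = LinearMap.id + h • (A : E →ₗ[ℝ] E) := rfl
    rw [this, map_add, map_smul, LinearMap.toMatrix_id]
  rw [h, LinearMap.trace_eq_matrix_trace ℝ b]
  have hp := (Polynomial.hasDerivAt
    (Matrix.det (1 + (Polynomial.X : Polynomial ℝ) • M.map Polynomial.C)).divX.divX (0 : ℝ)).mul
      (hasDerivAt_pow 2 (0 : ℝ))
  have := (((hasDerivAt_id (0 : ℝ)).const_mul M.trace).const_add 1).add hp
  simpa [Pi.add_def, Pi.mul_def, M] using this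

theorem exists_abs_det_one_add_smul_le (C : ℝ) {ε : ℝ} (hε : 0 < ε) :
    ∃ h₀ : ℝ, 0 < h₀ ∧ ∀ h : ℝ, 0 ≤ h → h ≤ h₀ → ∀ A : E →L[ℝ] E, ‖A‖ ≤ C →
      LinearMap.trace ℝ E A = 0 → |(1 + h • A).det| ≤ 1 + ε * h := by
  have hd := (differentiable_det (E := E) 1).hasFDerivAt
  have hzero : ∀ A : E →L[ℝ] E, LinearMap.trace ℝ E A = 0 →
      fderiv ℝ (fun A : E →L[ℝ] E => A.det) 1 A = 0 := fun A hA => by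
    have h1 : HasDerivAt (fun h : ℝ => 1 + h • A) A 0 := by
      simpa using ((hasDerivAt_id (0 : ℝ)).smul_const A).const_add 1
    have h2 : HasFDerivAt (fun A : E →L[ℝ] E => A.det)
      (fderiv ℝ (fun A : E →L[ℝ] E => A.det) 1) ((fun h : ℝ => 1 + h • A) 0) := by simpa using hd
    have h3 := h2.comp_hasDerivAt (0 : ℝ) h1
    rw [← hA]
    exact h3.unique (hasDerivAt_det_one_add_smul A)
  have hC : 0 < |C| + 1 := by positivity
  have hev := (hasFDerivAt_iff_isLittleO.1 hd).def (c := ε / (|C| + 1)) (by positivity)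
  obtain ⟨δ, hδ, hball⟩ := Metric.eventually_nhds_iff.1 hev
  refine ⟨δ / (|C| + 1) / 2, by positivity, fun h h0 hh A hA ht => ?_⟩
  have hn : ‖h • A‖ ≤ h * (|C| + 1) := by
    rw [norm_smul, Real.norm_of_nonneg h0]
    gcongr
    linarith [le_abs_self C]
  have hlt : dist (1 + h • A) 1 < δ := by
    rw [dist_eq_norm, add_sub_cancel_left]
    refine hn.trans_lt ?_
    calc h * (|C| + 1) ≤ δ / (|C| + 1) / 2 * (|C| + 1) := by gcongr
      _ = δ / 2 := by field_simp
      _ < δ := by linarith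
  have h4 := hball hlt
  rw [add_sub_cancel_left, map_smul, hzero A ht, smul_zero, sub_zero] at h4
  have h5 : (1 : E →L[ℝ] E).det = 1 := by simp [ContinuousLinearMap.det]
  rw [h5, Real.norm_eq_abs] at h4
  have h6 : ε / (|C| + 1) * ‖h • A‖ ≤ ε * h := by
    calc ε / (|C| + 1) * ‖h • A‖ ≤ ε / (|C| + 1) * (h * (|C| + 1)) := by gcongr
      _ = ε * h := by field_simp
  have h7 := abs_sub_abs_le_abs_sub ((1 + h • A).det) 1
  rw [abs_one] at h7
  linarith

end Liouville

section Liouville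

open Set Metric
open scoped NNReal Topology RealInnerProductSpace

variable {E : Type*} [NormedAddCommGroup E] [InnerProductSpace ℝ E] [FiniteDimensional ℝ E]

namespace IsFlow

variable {X : E → E} {φ : ℝ → E → E}

theorem exists_dist_le_euler (hφ : IsFlow X φ) (hX : ContDiff ℝ 2 X) (hi : ∀ x, ⟪x, X x⟫ = 0)
    (r : ℝ) : ∃ C h₀ : ℝ, 0 ≤ C ∧ 0 < h₀ ∧ ∀ t, 0 ≤ t → t ≤ h₀ → ∀ x y, ‖x‖ ≤ r → ‖y‖ ≤ r →
      dist (φ t x) (φ t y) ≤ (1 + C * t ^ 2) * dist (x + t • X x) (y + t • X y) := by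
  have hX1 : ContDiff ℝ 1 X := hX.of_le (by norm_num)
  have hW : ContDiff ℝ 1 (fun x => fderiv ℝ X x (X x)) :=
    (hX.fderiv_right (m := 1) (by norm_num)).clm_apply hX1
  obtain ⟨K, hK⟩ := exists_lipschitzOnWith_closedBall hX1 r
  obtain ⟨K', hK'⟩ := exists_lipschitzOnWith_closedBall hW r
  set c : ℝ := K' * Real.exp K with hc
  have hc0 : 0 ≤ c := by positivity
  refine ⟨2 * c, min 1 (1 / (2 * (K + 1))), by positivity, by positivity,
    fun t ht0 ht x y hx hy => ?_⟩
  have ht1 : t ≤ 1 := ht.trans (min_le_left _ _)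
  have ht2 : t * K ≤ 1 / 2 := by
    have h1 : t ≤ 1 / (2 * (K + 1)) := ht.trans (min_le_right _ _)
    rw [le_div_iff₀ (by positivity)] at h1
    nlinarith
  have hmem : ∀ s z, ‖z‖ ≤ r → φ s z ∈ closedBall (0 : E) r := fun s z hz => by
    rw [mem_closedBall_zero_iff, hφ.norm_eq hi]; exact hz
  set Z : ℝ → E := fun s => X (φ s x) - X (φ s y) with hZ
  have hZd : ∀ s, HasDerivAt Z
      (fderiv ℝ X (φ s x) (X (φ s x)) - fderiv ℝ X (φ s y) (X (φ s y))) s := fun s =>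
    ((hX1.differentiable one_ne_zero _).hasFDerivAt.comp_hasDerivAt s (hφ.deriv x s)).sub
      ((hX1.differentiable one_ne_zero _).hasFDerivAt.comp_hasDerivAt s (hφ.deriv y s))
  have hZb : ∀ s ∈ Icc (0 : ℝ) t, ‖Z s - Z 0‖ ≤ c * dist x y * t := by
    intro s hs
    have := norm_image_sub_le_of_norm_deriv_le_segment' (C := c * dist x y)
      (fun s _ => (hZd s).hasDerivWithinAt) (fun s hs' => ?_) s hs
    · refine this.trans ?_
      rw [sub_zero]
      gcongr
      exact hs.2
    · rw [← dist_eq_norm]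
      refine (hK'.dist_le_mul _ (hmem s x hx) _ (hmem s y hy)).trans ?_
      have h1 := hφ.dist_le hi hK hx hy hs'.1
      have h2 : Real.exp (K * s) ≤ Real.exp K := by
        rw [Real.exp_le_exp]
        exact mul_le_of_le_one_right K.2 (hs'.2.le.trans ht1)
      calc (K' : ℝ) * dist (φ s x) (φ s y) ≤ K' * (dist x y * Real.exp K) := by
            gcongr
            exact h1.trans (by gcongr)
        _ = c * dist x y := by rw [hc]; ring
  have hed : ∀ s, HasDerivAt (fun s => φ s x - φ s y - s • Z 0) (Z s - Z 0) s := fun s => by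
    have := ((hφ.deriv x s).sub (hφ.deriv y s)).sub ((hasDerivAt_id s).smul_const (Z 0))
    rw [one_smul] at this
    exact this
  have he := norm_image_sub_le_of_norm_deriv_le_segment' (C := c * dist x y * t)
      (fun s _ => (hed s).hasDerivWithinAt) (fun s hs' => hZb s (Ico_subset_Icc_self hs'))
      t ⟨ht0, le_rfl⟩
  simp only [hφ.zero, zero_smul, sub_zero] at he
  set p := x + t • X x with hp
  set q := y + t • X y with hq
  have hZ0 : t • Z 0 = p - q - (x - y) := by
    simp only [hZ, hφ.zero, hp, hq, smul_sub]; abel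
  rw [hZ0] at he
  have h3 : dist x y ≤ 2 * dist p q := by
    have h4 : ‖t • Z 0‖ ≤ 1 / 2 * dist x y := by
      have := hK.dist_le_mul x (by simpa using hx) y (by simpa using hy)
      simp only [hZ, hφ.zero]
      rw [norm_smul, Real.norm_of_nonneg ht0, ← dist_eq_norm]
      calc t * dist (X x) (X y) ≤ t * (K * dist x y) := by gcongr
        _ = (t * K) * dist x y := by ring
        _ ≤ _ := by gcongr
    rw [hZ0] at h4
    have h5 : ‖x - y‖ ≤ ‖p - q‖ + ‖p - q - (x - y)‖ := by
      have := norm_sub_le (p - q) (p - q - (x - y))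
      simpa using this
    rw [← dist_eq_norm, ← dist_eq_norm] at h5
    linarith
  have h6 : ‖φ t x - φ t y‖ ≤ ‖φ t x - φ t y - (p - q - (x - y)) - (x - y)‖ + ‖p - q‖ := by
    have := norm_add_le (φ t x - φ t y - (p - q - (x - y)) - (x - y)) (p - q)
    rwa [show φ t x - φ t y - (p - q - (x - y)) - (x - y) + (p - q) = φ t x - φ t y by abel] at this
  rw [← dist_eq_norm, ← dist_eq_norm p q] at h6
  have h7 : c * dist x y * t * t ≤ 2 * c * t ^ 2 * dist p q := by
    calc c * dist x y * t * t ≤ c * (2 * dist p q) * t * t := by gcongr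
      _ = _ := by ring
  linarith

theorem image_eq_preimage (hφ : IsFlow X φ) (hX : ContDiff ℝ 1 X) (hi : ∀ x, ⟪x, X x⟫ = 0)
    (t : ℝ) (B : Set E) : φ t '' B = φ (-t) ⁻¹' B :=
  congrFun (image_eq_preimage_of_inverse (hφ.neg_comp hX hi t)
    (fun x => by simpa using hφ.neg_comp hX hi (-t) x)) B

variable [MeasurableSpace E] [BorelSpace E]

open Measure in
theorem exists_hausdorffMeasure_image_le (hφ : IsFlow X φ) (hX : ContDiff ℝ 2 X)
    (hi : ∀ x, ⟪x, X x⟫ = 0) (htr : ∀ x, LinearMap.trace ℝ E (fderiv ℝ X x) = 0) (r : ℝ)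
    {ε : ℝ} (hε : 0 < ε) : ∃ h₀ : ℝ, 0 < h₀ ∧ ∀ t, 0 ≤ t → t ≤ h₀ → ∀ B ⊆ closedBall (0 : E) r,
      MeasurableSet B → μH[Module.finrank ℝ E] (φ t '' B) ≤
        ENNReal.ofReal (Real.exp (ε * t)) * μH[Module.finrank ℝ E] B := by
  set d := Module.finrank ℝ E with hd
  have hX1 : ContDiff ℝ 1 X := hX.of_le (by norm_num)
  obtain ⟨C, h₁, hC, hh₁, hdist⟩ := hφ.exists_dist_le_euler hX hi r
  obtain ⟨M, hM⟩ := (isCompact_closedBall (0 : E) r).exists_bound_of_continuousOn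
    (hX1.continuous_fderiv one_ne_zero).continuousOn
  obtain ⟨h₂, hh₂, hdet⟩ := exists_abs_det_one_add_smul_le (E := E) M (half_pos hε)
  refine ⟨min (min h₁ h₂) (ε / 2 / (d * C + 1)), by positivity, fun t ht0 ht B hB hBm => ?_⟩
  have ht1 : t ≤ h₁ := ht.trans ((min_le_left _ _).trans (min_le_left _ _))
  have ht2 : t ≤ h₂ := ht.trans ((min_le_left _ _).trans (min_le_right _ _))
  have ht3 : d * C * t ≤ ε / 2 := by
    have h1 : t ≤ ε / 2 / (d * C + 1) := ht.trans (min_le_right _ _)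
    rw [le_div_iff₀ (by positivity)] at h1
    linarith
  have hB' : ∀ x ∈ B, ‖x‖ ≤ r := fun x hx => mem_closedBall_zero_iff.1 (hB hx)
  have s1 := hausdorffMeasure_image_le_of_dist_le (f := φ t) (g := fun x => x + t • X x)
    (B := B) (K := (1 + C * t ^ 2).toNNReal) (d := d)
    (fun x hx y hy => by
      rw [Real.coe_toNNReal _ (by positivity)]
      exact hdist t ht0 ht1 x y (hB' x hx) (hB' y hy)) (by positivity)
  have s2 := addHaar_image_le_lintegral_abs_det_fderiv (μH[d] : Measure E)
    (f := fun x => x + t • X x) (f' := fun x => 1 + t • fderiv ℝ X x) hBm (fun x _ =>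
      ((hasFDerivAt_id x).add
        ((hX1.differentiable one_ne_zero x).hasFDerivAt.const_smul t)).hasFDerivWithinAt)
  have s3 : ∫⁻ x in B, ENNReal.ofReal |(1 + t • fderiv ℝ X x).det| ∂(μH[d] : Measure E) ≤
      ENNReal.ofReal (1 + ε / 2 * t) * μH[d] B := by
    rw [← setLIntegral_const]
    refine setLIntegral_mono measurable_const fun x hx => ENNReal.ofReal_le_ofReal ?_
    exact hdet t ht0 ht2 _ (hM x (hB hx)) (htr x)
  refine s1.trans ((mul_le_mul_right (s2.trans s3) _).trans ?_)
  rw [← mul_assoc]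
  gcongr
  rw [ENNReal.rpow_natCast]
  change ENNReal.ofReal (1 + C * t ^ 2) ^ d * _ ≤ _
  rw [← ENNReal.ofReal_pow (by positivity), ← ENNReal.ofReal_mul (by positivity)]
  apply ENNReal.ofReal_le_ofReal
  have e1 : 1 + C * t ^ 2 ≤ Real.exp (C * t ^ 2) := by
    rw [add_comm]; exact Real.add_one_le_exp _
  have e2 : 1 + ε / 2 * t ≤ Real.exp (ε / 2 * t) := by
    rw [add_comm]; exact Real.add_one_le_exp _
  calc (1 + C * t ^ 2) ^ d * (1 + ε / 2 * t)
      ≤ Real.exp (C * t ^ 2) ^ d * Real.exp (ε / 2 * t) := by gcongr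
    _ = Real.exp (d * C * t * t + ε / 2 * t) := by
      rw [← Real.exp_nat_mul, ← Real.exp_add]; ring_nf
    _ ≤ Real.exp (ε * t) := by
      rw [Real.exp_le_exp]
      nlinarith

open Measure in
theorem hausdorffMeasure_image_le (hφ : IsFlow X φ) (hX : ContDiff ℝ 2 X)
    (hi : ∀ x, ⟪x, X x⟫ = 0) (htr : ∀ x, LinearMap.trace ℝ E (fderiv ℝ X x) = 0) {r : ℝ}
    {t : ℝ} (ht : 0 ≤ t) {B : Set E} (hB : B ⊆ closedBall (0 : E) r) (hBm : MeasurableSet B) :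
    μH[Module.finrank ℝ E] (φ t '' B) ≤ μH[Module.finrank ℝ E] B := by
  have hX1 : ContDiff ℝ 1 X := hX.of_le (by norm_num)
  have key : ∀ ε : ℝ, 0 < ε → μH[Module.finrank ℝ E] (φ t '' B) ≤
      ENNReal.ofReal (Real.exp (ε * t)) * μH[Module.finrank ℝ E] B := by
    intro ε hε
    obtain ⟨h₀, hh₀, hstep⟩ := hφ.exists_hausdorffMeasure_image_le hX hi htr r hε
    obtain ⟨m, hm⟩ := exists_nat_gt (t / h₀)
    have hm0 : (0 : ℝ) < m := (div_nonneg ht hh₀.le).trans_lt hm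
    set h := t / m with hh
    have hh0 : 0 ≤ h := by positivity
    have hle : h ≤ h₀ := by
      rw [hh, div_le_iff₀ hm0]
      rw [div_lt_iff₀ hh₀] at hm
      linarith
    have hind : ∀ k : ℕ, μH[Module.finrank ℝ E] (φ (k * h) '' B) ≤
        ENNReal.ofReal (Real.exp (ε * (k * h))) * μH[Module.finrank ℝ E] B := by
      intro k
      induction k with
      | zero => simp [hφ.zero]
      | succ k ih =>
        have himg : φ ((k + 1 : ℕ) * h) '' B = φ h '' (φ (k * h) '' B) := by
          rw [image_image]
          refine image_congr fun x _ => ?_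
          rw [← hφ.add hX1 hi]
          congr 1
          push_cast
          ring
        rw [himg]
        refine (hstep h hh0 hle _ ?_ ?_).trans ?_
        · rintro _ ⟨x, hx, rfl⟩
          rw [mem_closedBall_zero_iff, hφ.norm_eq hi]
          exact mem_closedBall_zero_iff.1 (hB hx)
        · rw [hφ.image_eq_preimage hX1 hi]
          exact (hφ.continuous hX1 hi _).measurable hBm
        · refine (mul_le_mul_right ih _).trans_eq ?_
          rw [← mul_assoc, ← ENNReal.ofReal_mul (by positivity), ← Real.exp_add]
          congr 3
          push_cast
          ring
    have := hind m
    rwa [show (m : ℝ) * h = t by rw [hh]; field_simp] at this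
  have hlim : Filter.Tendsto (fun ε : ℝ => ENNReal.ofReal (Real.exp (ε * t)) *
      μH[Module.finrank ℝ E] B) (𝓝[>] 0) (𝓝 (1 * μH[Module.finrank ℝ E] B)) := by
    refine ENNReal.Tendsto.mul_const ?_ (Or.inl one_ne_zero)
    have : ENNReal.ofReal (Real.exp (0 * t)) = 1 := by simp
    rw [← this]
    refine tendsto_nhdsWithin_of_tendsto_nhds (Continuous.tendsto ?_ 0)
    exact ENNReal.continuous_ofReal.comp (by fun_prop)
  rw [one_mul] at hlim
  exact ge_of_tendsto hlim (by filter_upwards [self_mem_nhdsWithin] with ε hε using key ε hε)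

open Measure in
/-- **Liouville's theorem** for divergence-free vector fields tangent to spheres. -/
theorem measurePreserving (hφ : IsFlow X φ) (hX : ContDiff ℝ 2 X)
    (hi : ∀ x, ⟪x, X x⟫ = 0) (htr : ∀ x, LinearMap.trace ℝ E (fderiv ℝ X x) = 0)
    (μ : Measure E) [μ.IsAddHaarMeasure] (t : ℝ) : MeasurePreserving (φ t) μ μ := by
  have hX1 : ContDiff ℝ 1 X := hX.of_le (by norm_num)
  have hcont := hφ.continuous hX1 hi
  have hle : ∀ s : ℝ, ∀ r : ℝ, ∀ B ⊆ closedBall (0 : E) r, MeasurableSet B →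
      μH[Module.finrank ℝ E] (φ s '' B) ≤ μH[Module.finrank ℝ E] B := by
    intro s r B hB hBm
    rcases le_total 0 s with hs | hs
    · exact hφ.hausdorffMeasure_image_le hX hi htr hs hB hBm
    · have htr' : ∀ x, LinearMap.trace ℝ E (fderiv ℝ (fun x => -X x) x) = 0 := fun x => by
        have : fderiv ℝ (fun x => -X x) x = -fderiv ℝ X x := fderiv_neg
        rw [this, ContinuousLinearMap.toLinearMap_neg, map_neg, htr, neg_zero]
      have := hφ.neg.hausdorffMeasure_image_le hX.neg (fun x => by simp [hi]) htr'
        (neg_nonneg.2 hs) hB hBm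
      simpa using this
  have hpre : ∀ s : ℝ, ∀ B : Set E, MeasurableSet B → MeasurableSet (φ s ⁻¹' B) := fun s B hB =>
    (hcont s).measurable hB
  have hball : ∀ B ⊆ (univ : Set E), MeasurableSet B → ∀ n : ℕ,
      μH[Module.finrank ℝ E] (φ t ⁻¹' B ∩ closedBall 0 n) =
        μH[Module.finrank ℝ E] (B ∩ closedBall 0 n) := by
    intro B _ hB n
    have himg : φ t ⁻¹' B ∩ closedBall 0 n = φ (-t) '' (B ∩ closedBall 0 n) := by
      rw [hφ.image_eq_preimage hX1 hi, neg_neg, preimage_inter]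
      congr 1
      ext x
      simp [hφ.norm_eq hi]
    have himg' : B ∩ closedBall 0 n = φ t '' (φ t ⁻¹' B ∩ closedBall 0 n) := by
      rw [himg, image_image]
      have h1 : ∀ x, φ t (φ (-t) x) = x := fun x => by simpa using hφ.neg_comp hX1 hi (-t) x
      simp [h1]
    apply le_antisymm
    · rw [himg]
      exact hle _ n _ inter_subset_right (hB.inter measurableSet_closedBall)
    · conv_lhs => rw [himg']
      exact hle _ n _ inter_subset_right ((hpre t B hB).inter measurableSet_closedBall)
  have hmain : ∀ B : Set E, MeasurableSet B → μH[Module.finrank ℝ E] (φ t ⁻¹' B) =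
      μH[Module.finrank ℝ E] B := by
    intro B hB
    have hU : ∀ A : Set E, μH[Module.finrank ℝ E] A =
        ⨆ n : ℕ, μH[Module.finrank ℝ E] (A ∩ closedBall 0 n) := fun A => by
      rw [← Monotone.measure_iUnion, ← inter_iUnion, iUnion_closedBall_nat, inter_univ]
      intro m n hmn
      exact inter_subset_inter_right _ (closedBall_subset_closedBall (by exact_mod_cast hmn))
    rw [hU, hU B]
    exact iSup_congr fun n => hball B (subset_univ _) hB n
  refine ⟨(hcont t).measurable, Measure.ext fun B hB => ?_⟩
  rw [map_apply (hcont t).measurable hB,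
    isAddLeftInvariant_eq_smul μ (μH[Module.finrank ℝ E] : Measure E), Measure.smul_apply, Measure.smul_apply,
    hmain B hB]

end IsFlow

end Liouville

/-! ### Cubic Hamiltonian vector fields -/

section Cubic

open scoped RealInnerProductSpace ComplexConjugate

variable {ι : Type*} [Fintype ι]

/-- The vector field with components `∑ c a b d n x_a x_b conj x_d`. -/
def cubicField (c : ι → ι → ι → ι → ℝ) (x : EuclideanSpace ℂ ι) : EuclideanSpace ℂ ι :=
  WithLp.toLp 2 fun n => ∑ a, ∑ b, ∑ d, (c a b d n : ℂ) * x a * x b * conj (x d)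

theorem cubicField_apply (c : ι → ι → ι → ι → ℝ) (x : EuclideanSpace ℂ ι) (n : ι) :
    cubicField c x n = ∑ a, ∑ b, ∑ d, (c a b d n : ℂ) * x a * x b * conj (x d) := rfl

theorem contDiff_cubicField (c : ι → ι → ι → ι → ℝ) {m : WithTop ℕ∞} :
    ContDiff ℝ m (cubicField c) := by
  have hp : ∀ a : ι, ContDiff ℝ m (fun x : EuclideanSpace ℂ ι => x a) := fun a =>
    (EuclideanSpace.proj (𝕜 := ℂ) a).restrictScalars ℝ |>.contDiff
  have hc : ∀ a : ι, ContDiff ℝ m (fun x : EuclideanSpace ℂ ι => conj (x a)) := fun a =>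
    Complex.conjCLE.contDiff.comp (hp a)
  rw [contDiff_piLp]
  intro n
  simp only [cubicField_apply]
  exact ContDiff.sum fun a _ => ContDiff.sum fun b _ => ContDiff.sum fun d _ =>
    ((contDiff_const.mul (hp a)).mul (hp b)).mul (hc d)

/-- The real part of `x_a x_b conj x_d conj x_e`. -/
def quarticRe {κ : Type*} (x : κ → ℂ) (a b d e : κ) : ℝ := (x a * x b * conj (x d) * conj (x e)).re

theorem quarticRe_swap {κ : Type*} (x : κ → ℂ) (a b d e : κ) : quarticRe x d e a b = quarticRe x a b d e := by
  unfold quarticRe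
  rw [← Complex.conj_re]
  congr 1
  simp only [map_mul, Complex.conj_conj]
  ring

theorem quarticRe_comm_right {κ : Type*} (x : κ → ℂ) (a b d e : κ) :
    quarticRe x a b e d = quarticRe x a b d e := by
  unfold quarticRe
  congr 1
  ring

theorem abs_quarticRe_le {κ : Type*} (x : κ → ℂ) (a b d e : κ) :
    |quarticRe x a b d e| ≤ ‖x a‖ * ‖x b‖ * ‖x d‖ * ‖x e‖ := by
  refine (Complex.abs_re_le_norm _).trans_eq ?_
  simp

theorem sum_four_swap {M : Type*} [AddCommMonoid M] (F : ι → ι → ι → ι → M) :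
    ∑ a, ∑ b, ∑ d, ∑ e, F a b d e = ∑ a, ∑ b, ∑ d, ∑ e, F d e a b := by
  have h : ∀ G : ι → ι → ι → ι → M, ∑ a, ∑ b, ∑ d, ∑ e, G a b d e =
      ∑ p : ι × ι, ∑ q : ι × ι, G p.1 p.2 q.1 q.2 := fun G => by
    simp only [Fintype.sum_prod_type]
  rw [h, h, Finset.sum_comm]

variable {c : ι → ι → ι → ι → ℝ}

theorem sum_mul_re_conj_mul_cubicField (hsym : ∀ a b d e, c a b d e = c b a d e)
    (hanti : ∀ a b d e, c d e a b = -c a b d e) (q : ι → ℝ) (x : EuclideanSpace ℂ ι) :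
    4 * ∑ n, q n * (conj (x n) * cubicField c x n).re =
      ∑ a, ∑ b, ∑ d, ∑ e, c a b d e * (q d + q e - q a - q b) * quarticRe x a b d e := by
  have hsym' : ∀ a b d e, c a b e d = c a b d e := fun a b d e => by
    rw [← neg_inj, ← hanti, ← hanti, hsym]
  have h0 : ∑ n, q n * (conj (x n) * cubicField c x n).re =
      ∑ a, ∑ b, ∑ d, ∑ e, c a b d e * q e * quarticRe x a b d e := by
    have h1 : ∀ n, q n * (conj (x n) * cubicField c x n).re =
        ∑ a, ∑ b, ∑ d, c a b d n * q n * quarticRe x a b d n := fun n => by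
      simp only [cubicField_apply, Finset.mul_sum, Complex.re_sum]
      refine Finset.sum_congr rfl fun a _ => Finset.sum_congr rfl fun b _ =>
        Finset.sum_congr rfl fun d _ => ?_
      have : conj (x n) * ((c a b d n : ℂ) * x a * x b * conj (x d)) =
          (c a b d n : ℂ) * (x a * x b * conj (x d) * conj (x n)) := by ring
      rw [this, Complex.re_ofReal_mul, quarticRe]
      ring
    simp only [h1]
    rw [Finset.sum_comm]
    refine Finset.sum_congr rfl fun a _ => ?_
    rw [Finset.sum_comm]
    refine Finset.sum_congr rfl fun b _ => ?_
    rw [Finset.sum_comm]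
  have hd : ∑ a, ∑ b, ∑ d, ∑ e, c a b d e * q d * quarticRe x a b d e =
      ∑ a, ∑ b, ∑ d, ∑ e, c a b d e * q e * quarticRe x a b d e := by
    refine Finset.sum_congr rfl fun a _ => Finset.sum_congr rfl fun b _ => ?_
    rw [Finset.sum_comm]
    refine Finset.sum_congr rfl fun d _ => Finset.sum_congr rfl fun e _ => ?_
    rw [hsym', quarticRe_comm_right]
  have hb : ∑ a, ∑ b, ∑ d, ∑ e, c a b d e * q b * quarticRe x a b d e =
      -∑ a, ∑ b, ∑ d, ∑ e, c a b d e * q e * quarticRe x a b d e := by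
    rw [sum_four_swap]
    simp only [← Finset.sum_neg_distrib]
    refine Finset.sum_congr rfl fun a _ => Finset.sum_congr rfl fun b _ =>
      Finset.sum_congr rfl fun d _ => Finset.sum_congr rfl fun e _ => ?_
    rw [hanti, quarticRe_swap]
    ring
  have ha : ∑ a, ∑ b, ∑ d, ∑ e, c a b d e * q a * quarticRe x a b d e =
      -∑ a, ∑ b, ∑ d, ∑ e, c a b d e * q d * quarticRe x a b d e := by
    rw [sum_four_swap]
    simp only [← Finset.sum_neg_distrib]
    refine Finset.sum_congr rfl fun a _ => Finset.sum_congr rfl fun b _ =>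
      Finset.sum_congr rfl fun d _ => Finset.sum_congr rfl fun e _ => ?_
    rw [hanti, quarticRe_swap]
    ring
  simp only [mul_sub, mul_add, sub_mul, add_mul, Finset.sum_sub_distrib, Finset.sum_add_distrib]
  rw [ha, hb, hd, h0]
  ring

theorem inner_cubicField (hsym : ∀ a b d e, c a b d e = c b a d e)
    (hanti : ∀ a b d e, c d e a b = -c a b d e) (x : EuclideanSpace ℂ ι) :
    ⟪x, cubicField c x⟫ = 0 := by
  have h := sum_mul_re_conj_mul_cubicField hsym hanti (fun _ => 1) x
  have h2 : ⟪x, cubicField c x⟫ = ∑ n, 1 * (conj (x n) * cubicField c x n).re := by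
    rw [PiLp.inner_apply]
    simp [Complex.inner, mul_comm]
  rw [h2]
  simpa using h

theorem trace_fderiv_cubicField (hsym : ∀ a b d e, c a b d e = c b a d e)
    (hdiag : ∀ n b d, c n b d n = 0) (x : EuclideanSpace ℂ ι) :
    LinearMap.trace ℝ (EuclideanSpace ℂ ι) (fderiv ℝ (cubicField c) x) = 0 := by
  classical
  have hd := ((contDiff_cubicField c (m := 1)).differentiable one_ne_zero x).hasFDerivAt
  have key : ∀ (n : ι) (ξ : ℂ), fderiv ℝ (cubicField c) x (EuclideanSpace.single n ξ) n =
      (∑ a, ∑ b, (c a b n n : ℂ) * x a * x b) * conj ξ := by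
    intro n ξ
    set v := EuclideanSpace.single (𝕜 := ℂ) n ξ with hv
    have hline : HasDerivAt (fun s : ℝ => x + s • v) v 0 := by
      simpa using ((hasDerivAt_id (0 : ℝ)).smul_const v).const_add x
    have hd' : HasFDerivAt (cubicField c) (fderiv ℝ (cubicField c) x)
      ((fun s : ℝ => x + s • v) 0) := by simpa using hd
    have h1 := ((EuclideanSpace.proj (𝕜 := ℂ) n).restrictScalars ℝ).hasFDerivAt.comp_hasDerivAt
      (0 : ℝ) (hd'.comp_hasDerivAt (0 : ℝ) hline)
    have hco : ∀ a, HasDerivAt (fun s : ℝ => (x + s • v) a) (v a) 0 := fun a => by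
      have := ((EuclideanSpace.proj (𝕜 := ℂ) a).restrictScalars ℝ).hasFDerivAt.comp_hasDerivAt
        (0 : ℝ) hline
      exact this
    have hcc : ∀ a, HasDerivAt (fun s : ℝ => conj ((x + s • v) a)) (conj (v a)) 0 := fun a =>
      Complex.conjCLE.toContinuousLinearMap.hasFDerivAt.comp_hasDerivAt (0 : ℝ) (hco a)
    have h2 : HasDerivAt (fun s : ℝ => cubicField c (x + s • v) n)
        (∑ a, ∑ b, ∑ d, ((((c a b d n : ℂ) * v a) * x b + (c a b d n : ℂ) * x a * v b) * conj (x d)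
          + (c a b d n : ℂ) * x a * x b * conj (v d))) 0 := by
      simp only [cubicField_apply]
      refine HasDerivAt.fun_sum fun a _ => HasDerivAt.fun_sum fun b _ =>
        HasDerivAt.fun_sum fun d _ => ?_
      have := (((hco a).const_mul (c a b d n : ℂ)).mul (hco b)).mul (hcc d)
      simp only [Pi.mul_apply, zero_smul, add_zero] at this
      exact this
    have h3 := h1.unique h2
    refine Eq.trans (by exact h3) ?_
    rw [Finset.sum_mul]
    refine Finset.sum_congr rfl fun a _ => ?_
    rw [Finset.sum_mul]
    refine Finset.sum_congr rfl fun b _ => ?_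
    have h4 : ∀ d, (((c a b d n : ℂ) * v a) * x b + (c a b d n : ℂ) * x a * v b) * conj (x d)
          + (c a b d n : ℂ) * x a * x b * conj (v d) =
        if d = n then (c a b n n : ℂ) * x a * x b * conj ξ else 0 := by
      intro d
      have e1 : (c a b d n : ℂ) * v a = 0 := by
        by_cases h : a = n
        · subst h; simp [hdiag]
        · simp [hv, h]
      have e2 : (c a b d n : ℂ) * v b = 0 := by
        by_cases h : b = n
        · subst h; simp [hsym a, hdiag]
        · simp [hv, h]
      have e3 : (c a b d n : ℂ) * x a * v b = 0 := by
        rw [mul_right_comm, e2, zero_mul]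
      rw [e1, e3]
      by_cases h : d = n
      · subst h; simp [hv]
      · simp [hv, h]
    simp [h4]
  rw [LinearMap.trace_eq_sum_inner _ (Pi.orthonormalBasis fun _ : ι => Complex.orthonormalBasisOneI),
    Fintype.sum_sigma]
  refine Finset.sum_eq_zero fun n _ => ?_
  have hb : ∀ k : Fin 2, (Pi.orthonormalBasis fun _ : ι => Complex.orthonormalBasisOneI) ⟨n, k⟩ =
      EuclideanSpace.single n (Complex.orthonormalBasisOneI k) := fun k => by
    simp [Pi.orthonormalBasis_apply]
  have hin : ∀ (ξ : ℂ) (w : EuclideanSpace ℂ ι), ⟪EuclideanSpace.single n ξ, w⟫ =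
      (conj ξ * w n).re := fun ξ w => by
    rw [PiLp.inner_apply, Finset.sum_eq_single n]
    · simp [Complex.inner, mul_comm]
    · intro m _ hm
      simp [hm]
    · simp
  simp only [hb, hin, Fin.sum_univ_two, ContinuousLinearMap.coe_coe, key]
  simp [Complex.coe_orthonormalBasisOneI]

end Cubic

/-! ### A weighted quartic inequality -/

theorem sum_quartic_le (F : Finset ℤ) (f ω : ℤ → ℝ) (hω : ∀ n, 0 < ω n) {S : ℝ}
    (hS : ∑ n ∈ F, (ω n)⁻¹ ^ 2 ≤ S) :
    ∑ p ∈ F ×ˢ F, ∑ q ∈ F ×ˢ F,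
      (if p.1 + p.2 = q.1 + q.2 then f p.1 * f p.2 * (f q.1 * f q.2) else 0) ≤
      S * (∑ n ∈ F, ω n * f n ^ 2) ^ 2 := by
  set W : ℤ × ℤ → ℝ := fun p => ω p.1 * ω p.2 with hW
  set g : ℤ × ℤ → ℝ := fun p => f p.1 * f p.2 with hg
  have hWpos : ∀ p, 0 < W p := fun p => mul_pos (hω _) (hω _)
  have hinner : ∀ k : ℤ, ∑ q ∈ F ×ˢ F, (if k = q.1 + q.2 then (W q)⁻¹ else 0) ≤ S := by
    intro k
    have hfst : ∑ q ∈ F ×ˢ F, (if k = q.1 + q.2 then (ω q.1)⁻¹ ^ 2 else 0) ≤ S := by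
      rw [Finset.sum_product]
      refine (Finset.sum_le_sum fun a _ => ?_).trans hS
      have : ∀ b, (if k = a + b then (ω a)⁻¹ ^ 2 else 0) =
          if b = k - a then (ω a)⁻¹ ^ 2 else 0 := fun b => by
        congr 1
        exact propext ⟨fun h => by omega, fun h => by omega⟩
      simp only [this, Finset.sum_ite_eq']
      split_ifs
      · exact le_rfl
      · positivity
    have hsnd : ∑ q ∈ F ×ˢ F, (if k = q.1 + q.2 then (ω q.2)⁻¹ ^ 2 else 0) ≤ S := by
      rw [Finset.sum_product_right]
      rw [Finset.sum_product] at hfst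
      simpa only [add_comm] using hfst
    have hle : ∀ q ∈ F ×ˢ F, (if k = q.1 + q.2 then (W q)⁻¹ else 0) ≤
        1 / 2 * (if k = q.1 + q.2 then (ω q.1)⁻¹ ^ 2 else 0) +
        1 / 2 * (if k = q.1 + q.2 then (ω q.2)⁻¹ ^ 2 else 0) := by
      intro q _
      split_ifs
      · simp only [hW, mul_inv]
        nlinarith [sq_nonneg ((ω q.1)⁻¹ - (ω q.2)⁻¹)]
      · simp
    refine (Finset.sum_le_sum hle).trans ?_
    rw [Finset.sum_add_distrib, ← Finset.mul_sum, ← Finset.mul_sum]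
    linarith
  have hpt : ∀ p q, (if p.1 + p.2 = q.1 + q.2 then f p.1 * f p.2 * (f q.1 * f q.2) else 0) ≤
      1 / 2 * (g p ^ 2 * W p * (if p.1 + p.2 = q.1 + q.2 then (W q)⁻¹ else 0)) +
      1 / 2 * (g q ^ 2 * W q * (if q.1 + q.2 = p.1 + p.2 then (W p)⁻¹ else 0)) := by
    intro p q
    simp only [eq_comm (a := q.1 + q.2)]
    split_ifs
    · change g p * g q ≤ _
      have h1 := hWpos p
      have h2 := hWpos q
      have : 1 / 2 * (g p ^ 2 * W p * (W q)⁻¹) + 1 / 2 * (g q ^ 2 * W q * (W p)⁻¹) - g p * g q =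
          1 / 2 * (W p * g p - W q * g q) ^ 2 * ((W p)⁻¹ * (W q)⁻¹) := by
        field_simp
        ring
      have h3 : 0 ≤ 1 / 2 * (W p * g p - W q * g q) ^ 2 * ((W p)⁻¹ * (W q)⁻¹) := by positivity
      linarith
    · simp
  have hhalf : ∑ p ∈ F ×ˢ F, ∑ q ∈ F ×ˢ F,
      g p ^ 2 * W p * (if p.1 + p.2 = q.1 + q.2 then (W q)⁻¹ else 0) ≤
      S * (∑ n ∈ F, ω n * f n ^ 2) ^ 2 := by
    calc _ ≤ ∑ p ∈ F ×ˢ F, g p ^ 2 * W p * S := by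
          refine Finset.sum_le_sum fun p _ => ?_
          rw [← Finset.mul_sum]
          have := (hWpos p).le
          gcongr
          exact hinner _
      _ = S * (∑ n ∈ F, ω n * f n ^ 2) ^ 2 := by
          rw [← Finset.sum_mul, mul_comm, sq, Finset.sum_mul_sum, Finset.sum_product]
          congr 1
          refine Finset.sum_congr rfl fun a _ => Finset.sum_congr rfl fun b _ => ?_
          simp only [hg, hW]
          ring
  calc _ ≤ ∑ p ∈ F ×ˢ F, ∑ q ∈ F ×ˢ F,
        (1 / 2 * (g p ^ 2 * W p * (if p.1 + p.2 = q.1 + q.2 then (W q)⁻¹ else 0)) +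
        1 / 2 * (g q ^ 2 * W q * (if q.1 + q.2 = p.1 + p.2 then (W p)⁻¹ else 0))) :=
        Finset.sum_le_sum fun p _ => Finset.sum_le_sum fun q _ => hpt p q
    _ = ∑ p ∈ F ×ˢ F, ∑ q ∈ F ×ˢ F,
        g p ^ 2 * W p * (if p.1 + p.2 = q.1 + q.2 then (W q)⁻¹ else 0) := by
        simp only [Finset.sum_add_distrib]
        rw [Finset.sum_comm (f := fun p q : ℤ × ℤ =>
          1 / 2 * (g q ^ 2 * W q * (if q.1 + q.2 = p.1 + p.2 then (W p)⁻¹ else 0))),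
          ← Finset.sum_add_distrib]
        refine Finset.sum_congr rfl fun p _ => ?_
        rw [← Finset.sum_add_distrib]
        refine Finset.sum_congr rfl fun q _ => ?_
        ring
    _ ≤ _ := hhalf

/-! ### The weights -/

/-- The inverse variance `1 + |n|^{2α}` of the `n`-th Fourier coefficient under `γ_α`. -/
def prec (α : ℝ) (n : ℤ) : ℝ := 1 + |(n : ℝ)| ^ (2 * α)

/-- The Sobolev-type weight `(1 + |n|^{2α})^{1/3}`. -/
def weight (α : ℝ) (n : ℤ) : ℝ := prec α n ^ (1 / 3 : ℝ)

theorem one_le_prec (α : ℝ) (n : ℤ) : 1 ≤ prec α n := by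
  unfold prec
  have : 0 ≤ |(n : ℝ)| ^ (2 * α) := by positivity
  linarith

theorem prec_pos (α : ℝ) (n : ℤ) : 0 < prec α n := one_pos.trans_le (one_le_prec α n)

theorem weight_pos (α : ℝ) (n : ℤ) : 0 < weight α n := Real.rpow_pos_of_pos (prec_pos α n) _

theorem weight_pow_three (α : ℝ) (n : ℤ) : weight α n ^ 3 = prec α n := by
  rw [weight, ← Real.rpow_natCast, ← Real.rpow_mul (prec_pos α n).le]
  norm_num

theorem weight_div_prec (α : ℝ) (n : ℤ) : weight α n / prec α n = (weight α n)⁻¹ ^ 2 := by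
  have := (weight_pos α n).ne'
  rw [← weight_pow_three]
  field_simp

theorem summable_inv_weight_sq {α : ℝ} (hα : 3 / 4 < α) :
    Summable fun n : ℤ => (weight α n)⁻¹ ^ 2 := by
  have hs : Summable fun n : ℤ => |(n : ℝ)| ^ (-(4 * α / 3)) :=
    Real.summable_abs_int_rpow (by linarith)
  refine Summable.of_norm_bounded_eventually hs ?_
  have : ∀ᶠ n : ℤ in Filter.cofinite, n ≠ 0 :=
    (Set.finite_singleton (0 : ℤ)).compl_mem_cofinite
  filter_upwards [this] with n hn
  have hn' : 0 < |(n : ℝ)| := by positivity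
  rw [Real.norm_of_nonneg (by positivity), weight, ← Real.rpow_neg (prec_pos α n).le,
    ← Real.rpow_natCast, ← Real.rpow_mul (prec_pos α n).le]
  have h1 : |(n : ℝ)| ^ (-(4 * α / 3)) = (|(n : ℝ)| ^ (2 * α)) ^ (-(1 / 3) * ((2 : ℕ) : ℝ)) := by
    rw [← Real.rpow_mul hn'.le]
    congr 1
    push_cast
    ring
  rw [h1]
  refine Real.rpow_le_rpow_of_nonpos (by positivity) ?_ (by norm_num)
  simp [prec]

theorem summable_inv_prec {α : ℝ} (hα : 3 / 4 < α) : Summable fun n : ℤ => (prec α n)⁻¹ := by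
  refine Summable.of_nonneg_of_le (fun n => (inv_pos.2 (prec_pos α n)).le) (fun n => ?_)
    (summable_inv_weight_sq hα)
  rw [← weight_pow_three, inv_pow]
  have h1 : 1 ≤ weight α n := Real.one_le_rpow (one_le_prec α n) (by norm_num)
  exact inv_anti₀ (by positivity) (pow_le_pow_right₀ h1 (by norm_num))

/-- The sum of the squared inverse weights. -/
def weightSum (α : ℝ) : ℝ := ∑' n : ℤ, (weight α n)⁻¹ ^ 2

theorem sum_inv_weight_sq_le {α : ℝ} (hα : 3 / 4 < α) (F : Finset ℤ) :
    ∑ n ∈ F, (weight α n)⁻¹ ^ 2 ≤ weightSum α :=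
  (summable_inv_weight_sq hα).sum_le_tsum F fun n _ => by positivity

theorem weightSum_nonneg (α : ℝ) : 0 ≤ weightSum α := tsum_nonneg fun n => by positivity

/-! ### The truncated Birkhoff field in finite dimension -/

section Field

open scoped RealInnerProductSpace ComplexConjugate

/-- The finite-dimensional space of Fourier coefficients of order at most `N`. -/
abbrev Modes (N : ℕ) : Type := EuclideanSpace ℂ (freq N)

/-- The coefficients of the truncated Birkhoff field. -/
def birkhoffCoeff (α σ : ℝ) (N : ℕ) (a b d e : freq N) : ℝ :=
  if (a : ℤ) + b - d = e ∧ divisor α a b d e ≠ 0 then -σ / divisor α a b d e else 0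

theorem birkhoffCoeff_comm (α σ : ℝ) (N : ℕ) (a b d e : freq N) :
    birkhoffCoeff α σ N a b d e = birkhoffCoeff α σ N b a d e := by
  have h : divisor α b a d e = divisor α a b d e := by unfold divisor; ring
  unfold birkhoffCoeff
  rw [h, add_comm (a : ℤ)]

theorem birkhoffCoeff_swap (α σ : ℝ) (N : ℕ) (a b d e : freq N) :
    birkhoffCoeff α σ N d e a b = -birkhoffCoeff α σ N a b d e := by
  have h : divisor α d e a b = -divisor α a b d e := by unfold divisor; ring
  have h2 : ((d : ℤ) + e - a = b) ↔ ((a : ℤ) + b - d = e) := by omega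
  unfold birkhoffCoeff
  simp only [h, h2, ne_eq, neg_eq_zero, div_neg]
  split_ifs <;> simp

theorem birkhoffCoeff_diag (α σ : ℝ) (N : ℕ) (n b d : freq N) :
    birkhoffCoeff α σ N n b d n = 0 := by
  unfold birkhoffCoeff
  rw [if_neg]
  rintro ⟨h1, h2⟩
  have : (b : ℤ) = d := by omega
  apply h2
  rw [divisor, this]
  ring

theorem birkhoffCoeff_mul (α σ : ℝ) (hσ : |σ| ≤ 1) (N : ℕ) (a b d e : freq N) :
    |birkhoffCoeff α σ N a b d e * (prec α d + prec α e - prec α a - prec α b)| ≤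
      if (a : ℤ) + b = d + e then 1 else 0 := by
  have h : prec α d + prec α e - prec α a - prec α b = -divisor α a b d e := by
    unfold prec divisor; ring
  rw [h]
  unfold birkhoffCoeff
  split_ifs with h1 h2 h2
  · have : -σ / divisor α a b d e * -divisor α a b d e = σ := by
      field_simp [h1.2]
    rwa [this]
  · exact absurd (by omega) h2
  · simp
  · simp

/-- The weighted `ℓ²` norm squared. -/
def modeNorm (α : ℝ) (N : ℕ) (x : Modes N) : ℝ := ∑ n : freq N, weight α n * ‖x n‖ ^ 2

/-- The quadratic energy. -/
def modeEnergy (α : ℝ) (N : ℕ) (x : Modes N) : ℝ := ∑ n : freq N, prec α n * ‖x n‖ ^ 2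

theorem abs_sum_prec_mul_re_le {α σ : ℝ} (hα : 3 / 4 < α) (hσ : |σ| ≤ 1) (N : ℕ) (x : Modes N) :
    |2 * ∑ n : freq N, prec α n * (conj (x n) * cubicField (birkhoffCoeff α σ N) x n).re| ≤
      weightSum α * modeNorm α N x ^ 2 := by
  classical
  have h := sum_mul_re_conj_mul_cubicField (birkhoffCoeff_comm α σ N) (birkhoffCoeff_swap α σ N)
    (fun n => prec α n) x
  set f : ℤ → ℝ := fun n => if hn : n ∈ freq N then ‖x ⟨n, hn⟩‖ else 0 with hf
  have hfx : ∀ n : freq N, f n = ‖x n‖ := fun n => by simp [hf]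
  have hq := sum_quartic_le (freq N) f (weight α) (weight_pos α) (sum_inv_weight_sq_le hα (freq N))
  have hnorm : ∑ n ∈ freq N, weight α n * f n ^ 2 = modeNorm α N x := by
    rw [modeNorm, ← Finset.sum_coe_sort]
    simp only [hfx]
  rw [hnorm] at hq
  have hsum : |∑ a : freq N, ∑ b : freq N, ∑ d : freq N, ∑ e : freq N, birkhoffCoeff α σ N a b d e *
      (prec α d + prec α e - prec α a - prec α b) * quarticRe x a b d e| ≤
      weightSum α * modeNorm α N x ^ 2 := by
    refine le_trans ?_ hq
    simp only [Finset.sum_product, ← Finset.sum_coe_sort (freq N)]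
    refine (Finset.abs_sum_le_sum_abs _ _).trans (Finset.sum_le_sum fun a _ => ?_)
    refine (Finset.abs_sum_le_sum_abs _ _).trans (Finset.sum_le_sum fun b _ => ?_)
    refine (Finset.abs_sum_le_sum_abs _ _).trans (Finset.sum_le_sum fun d _ => ?_)
    refine (Finset.abs_sum_le_sum_abs _ _).trans (Finset.sum_le_sum fun e _ => ?_)
    rw [abs_mul]
    refine (mul_le_mul (birkhoffCoeff_mul α σ hσ N a b d e) (abs_quarticRe_le x a b d e)
      (abs_nonneg _) (by split_ifs <;> norm_num)).trans_eq ?_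
    simp only [hfx]
    split_ifs
    · ring
    · simp
  rw [← h, abs_mul, abs_of_pos (four_pos)] at hsum
  rw [abs_mul, abs_two]
  linarith [abs_nonneg (∑ n : freq N, prec α n *
    (conj (x n) * cubicField (birkhoffCoeff α σ N) x n).re)]

theorem exists_birkhoffFlow (α σ : ℝ) (N : ℕ) :
    ∃ φ, IsFlow (cubicField (birkhoffCoeff α σ N)) φ :=
  exists_isFlow (contDiff_cubicField _)
    (inner_cubicField (birkhoffCoeff_comm α σ N) (birkhoffCoeff_swap α σ N))

/-- The flow of the truncated Birkhoff field on the low modes. -/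
def modeFlow (α σ : ℝ) (N : ℕ) : ℝ → Modes N → Modes N := (exists_birkhoffFlow α σ N).choose

theorem isFlow_modeFlow (α σ : ℝ) (N : ℕ) :
    IsFlow (cubicField (birkhoffCoeff α σ N)) (modeFlow α σ N) :=
  (exists_birkhoffFlow α σ N).choose_spec

theorem inner_birkhoff (α σ : ℝ) (N : ℕ) (x : Modes N) :
    ⟪x, cubicField (birkhoffCoeff α σ N) x⟫ = 0 :=
  inner_cubicField (birkhoffCoeff_comm α σ N) (birkhoffCoeff_swap α σ N) x

theorem modeFlow_neg_comp (α σ : ℝ) (N : ℕ) (t : ℝ) (x : Modes N) :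
    modeFlow α σ N (-t) (modeFlow α σ N t x) = x :=
  (isFlow_modeFlow α σ N).neg_comp (contDiff_cubicField _) (inner_birkhoff α σ N) t x

theorem norm_modeFlow (α σ : ℝ) (N : ℕ) (t : ℝ) (x : Modes N) : ‖modeFlow α σ N t x‖ = ‖x‖ :=
  (isFlow_modeFlow α σ N).norm_eq (inner_birkhoff α σ N) t x

theorem continuous_modeFlow (α σ : ℝ) (N : ℕ) (t : ℝ) : Continuous (modeFlow α σ N t) :=
  (isFlow_modeFlow α σ N).continuous (contDiff_cubicField _) (inner_birkhoff α σ N) t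

theorem continuous_modeFlow_time (α σ : ℝ) (N : ℕ) (x : Modes N) :
    Continuous fun t => modeFlow α σ N t x :=
  continuous_iff_continuousAt.2 fun t => ((isFlow_modeFlow α σ N).deriv x t).continuousAt

theorem measurePreserving_modeFlow (α σ : ℝ) (N : ℕ) (t : ℝ) (μ : Measure (Modes N))
    [μ.IsAddHaarMeasure] : MeasurePreserving (modeFlow α σ N t) μ μ :=
  (isFlow_modeFlow α σ N).measurePreserving (contDiff_cubicField _) (inner_birkhoff α σ N)
    (trace_fderiv_cubicField (birkhoffCoeff_comm α σ N) (birkhoffCoeff_diag α σ N)) μ t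

theorem continuous_modeNorm (α : ℝ) (N : ℕ) : Continuous (modeNorm α N) := by
  unfold modeNorm
  fun_prop

theorem continuous_modeEnergy (α : ℝ) (N : ℕ) : Continuous (modeEnergy α N) := by
  unfold modeEnergy
  fun_prop

theorem modeNorm_nonneg (α : ℝ) (N : ℕ) (x : Modes N) : 0 ≤ modeNorm α N x :=
  Finset.sum_nonneg fun n _ => mul_nonneg (weight_pos α n).le (by positivity)

theorem hasDerivAt_modeEnergy (α σ : ℝ) (N : ℕ) (x : Modes N) (t : ℝ) :
    HasDerivAt (fun t => modeEnergy α N (modeFlow α σ N t x))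
      (2 * ∑ n : freq N, prec α n * (conj (modeFlow α σ N t x n) *
        cubicField (birkhoffCoeff α σ N) (modeFlow α σ N t x) n).re) t := by
  unfold modeEnergy
  rw [Finset.mul_sum]
  refine HasDerivAt.fun_sum fun n _ => ?_
  have h1 : HasDerivAt (fun t => modeFlow α σ N t x n)
      (cubicField (birkhoffCoeff α σ N) (modeFlow α σ N t x) n) t :=
    ((EuclideanSpace.proj (𝕜 := ℂ) n).restrictScalars ℝ).hasFDerivAt.comp_hasDerivAt t
      ((isFlow_modeFlow α σ N).deriv x t)
  have h2 := h1.norm_sq.const_mul (prec α n)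
  have e : ∀ z w : ℂ, 2 * (prec α n * (conj z * w).re) = prec α n * (2 * ⟪z, w⟫) := fun z w => by
    rw [Complex.inner, mul_comm (conj z)]
    ring
  exact (e _ _).symm ▸ h2

/-- The energy varies along the flow at a rate controlled by the square of the weighted norm. -/
theorem modeEnergy_sub_le {α σ : ℝ} (hα : 3 / 4 < α) (hσ : |σ| ≤ 1) (N : ℕ) (x : Modes N) (t : ℝ) :
    modeEnergy α N x - modeEnergy α N (modeFlow α σ N t x) ≤
      ∫ r in (0 : ℝ)..1, |t| * weightSum α * modeNorm α N (modeFlow α σ N (r * t) x) ^ 2 := by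
  set G : ℝ → ℝ := fun s => 2 * ∑ n : freq N, prec α n * (conj (modeFlow α σ N s x n) *
        cubicField (birkhoffCoeff α σ N) (modeFlow α σ N s x) n).re with hG
  have hct := continuous_modeFlow_time α σ N x
  have hfield : Continuous (cubicField (birkhoffCoeff α σ N)) :=
    (contDiff_cubicField (m := 0) _).continuous
  have hGc : Continuous G := by
    have h2 : ∀ n, Continuous fun s => cubicField (birkhoffCoeff α σ N) (modeFlow α σ N s x) n :=
      fun n => (EuclideanSpace.proj (𝕜 := ℂ) n).continuous.comp (hfield.comp hct)
    have h3 : ∀ n, Continuous fun s => modeFlow α σ N s x n :=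
      fun n => (EuclideanSpace.proj (𝕜 := ℂ) n).continuous.comp hct
    refine continuous_const.mul (continuous_finsetSum _ fun n _ => continuous_const.mul ?_)
    exact Complex.continuous_re.comp ((Complex.continuous_conj.comp (h3 n)).mul (h2 n))
  have hder : ∀ r : ℝ, HasDerivAt (fun r => -modeEnergy α N (modeFlow α σ N (r * t) x))
      (-(G (r * t) * t)) r := fun r => by
    have h1 : HasDerivAt (fun r : ℝ => r * t) t r := by
      simpa using (hasDerivAt_id r).mul_const t
    exact ((hasDerivAt_modeEnergy α σ N x (r * t)).comp r h1).neg
  have hcrt : Continuous fun r : ℝ => r * t := by fun_prop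
  have hI := intervalIntegral.integral_eq_sub_of_hasDerivAt (a := 0) (b := 1)
    (fun r _ => hder r) (Continuous.intervalIntegrable
      ((hGc.comp hcrt).mul continuous_const).neg 0 1)
  have h0 : modeFlow α σ N 0 x = x := (isFlow_modeFlow α σ N).zero x
  rw [one_mul, zero_mul, h0] at hI
  rw [show modeEnergy α N x - modeEnergy α N (modeFlow α σ N t x) =
    -modeEnergy α N (modeFlow α σ N t x) - -modeEnergy α N x by ring, ← hI]
  refine intervalIntegral.integral_mono_on zero_le_one
    (Continuous.intervalIntegrable ((hGc.comp hcrt).mul continuous_const).neg 0 1)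
    (Continuous.intervalIntegrable (continuous_const.mul
      (((continuous_modeNorm α N).comp (hct.comp hcrt)).pow 2)) 0 1) fun r _ => ?_
  have hb := abs_sum_prec_mul_re_le hα hσ N (modeFlow α σ N (r * t) x)
  calc -(G (r * t) * t) ≤ |G (r * t) * t| := neg_le_abs _
    _ = |t| * |G (r * t)| := by rw [abs_mul, mul_comm]
    _ ≤ |t| * (weightSum α * modeNorm α N (modeFlow α σ N (r * t) x) ^ 2) := by gcongr
    _ = _ := by ring

end Field

/-! ### The flow on `L²` -/

section FlowL2

open scoped ComplexConjugate

/-- The `n`-th Fourier coefficient, as a continuous linear form. -/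
def coef (n : ℤ) : L2 →L[ℂ] ℂ := innerSL ℂ (fourierLp 2 n : L2)

theorem coef_apply (n : ℤ) (u : L2) : coef n u = fourierCoeff u n := by
  rw [← fourierBasis_repr, HilbertBasis.repr_apply_apply, coe_fourierBasis]
  rfl

theorem coef_fourierLp (m n : ℤ) : coef m (fourierLp 2 n : L2) = if m = n then 1 else 0 :=
  (orthonormal_iff_ite.1 orthonormal_fourier) m n

theorem ext_coef {u v : L2} (h : ∀ n, coef n u = coef n v) : u = v := by
  apply fourierBasis.repr.injective
  ext n
  rw [fourierBasis_repr, fourierBasis_repr, ← coef_apply, ← coef_apply, h]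

theorem hasSum_norm_coef_sq (u : L2) : HasSum (fun n => ‖coef n u‖ ^ 2) (‖u‖ ^ 2) := by
  have h := lp.hasSum_norm (p := 2) (by norm_num) (fourierBasis.repr u)
  rw [LinearIsometryEquiv.norm_map] at h
  simpa [fourierBasis_repr, ← coef_apply] using h

/-- The Fourier coefficients of order at most `N`. -/
def lowProj (N : ℕ) : L2 →L[ℂ] Modes N :=
  (EuclideanSpace.equiv (freq N) ℂ).symm.toContinuousLinearMap ∘L
    ContinuousLinearMap.pi fun n : freq N => coef n

theorem lowProj_apply (N : ℕ) (u : L2) (n : freq N) : lowProj N u n = coef n u := rfl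

/-- The trigonometric polynomial with given Fourier coefficients. -/
def incl (N : ℕ) : Modes N →L[ℂ] L2 :=
  ∑ n : freq N, (EuclideanSpace.proj (𝕜 := ℂ) n).smulRight (fourierLp 2 n : L2)

theorem incl_apply (N : ℕ) (x : Modes N) : incl N x = ∑ n : freq N, x n • (fourierLp 2 n : L2) := by
  simp [incl]

theorem coef_incl_mem (N : ℕ) (x : Modes N) (n : freq N) : coef n (incl N x) = x n := by
  rw [incl_apply, map_sum, Finset.sum_eq_single n]
  · rw [map_smul, coef_fourierLp]
    simp
  · intro m _ hm
    rw [map_smul, coef_fourierLp, if_neg (fun h => hm (Subtype.ext h.symm)), smul_zero]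
  · simp

theorem coef_incl_notMem (N : ℕ) (x : Modes N) {n : ℤ} (hn : n ∉ freq N) :
    coef n (incl N x) = 0 := by
  rw [incl_apply, map_sum]
  refine Finset.sum_eq_zero fun m _ => ?_
  rw [map_smul, coef_fourierLp, if_neg (fun h : n = m => hn (h ▸ m.2)), smul_zero]

theorem lowProj_incl (N : ℕ) (x : Modes N) : lowProj N (incl N x) = x := by
  ext n
  rw [lowProj_apply, coef_incl_mem]

theorem field_eq (α σ : ℝ) (N : ℕ) (u : L2) :
    field α σ N u = incl N (cubicField (birkhoffCoeff α σ N) (lowProj N u)) := by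
  classical
  rw [field, incl_apply, ← Finset.sum_coe_sort]
  refine Finset.sum_congr rfl fun n _ => ?_
  congr 1
  rw [fieldCoeff, cubicField_apply, Finset.sum_filter]
  simp only [Finset.sum_product, ← Finset.sum_coe_sort (freq N)]
  refine Finset.sum_congr rfl fun a _ => Finset.sum_congr rfl fun b _ =>
    Finset.sum_congr rfl fun d _ => ?_
  simp only [lowProj_apply, coef_apply, birkhoffCoeff]
  split_ifs <;> simp

theorem isSolution_incl (α σ : ℝ) (N : ℕ) (u : L2) :
    IsSolution α σ N u fun t => u + incl N (modeFlow α σ N t (lowProj N u) - lowProj N u) := by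
  refine ⟨by simp [(isFlow_modeFlow α σ N).zero], fun t => ?_⟩
  have h1 := ((isFlow_modeFlow α σ N).deriv (lowProj N u) t).sub_const (lowProj N u)
  have h2 := (((incl N).restrictScalars ℝ).hasFDerivAt.comp_hasDerivAt t h1).const_add u
  have h3 : lowProj N (u + incl N (modeFlow α σ N t (lowProj N u) - lowProj N u)) =
      modeFlow α σ N t (lowProj N u) := by
    rw [map_add, lowProj_incl, add_sub_cancel]
  rw [field_eq, h3]
  exact h2

theorem IsSolution.eq {α σ : ℝ} {N : ℕ} {u : L2} {v : ℝ → L2} (hv : IsSolution α σ N u v) (t : ℝ) :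
    v t = u + incl N (modeFlow α σ N t (lowProj N u) - lowProj N u) := by
  have hder : ∀ s, HasDerivAt (fun s => lowProj N (v s))
      (cubicField (birkhoffCoeff α σ N) (lowProj N (v s))) s := fun s => by
    have h1 := ((lowProj N).restrictScalars ℝ).hasFDerivAt.comp_hasDerivAt s (hv.2 s)
    rw [field_eq] at h1
    have h2 := lowProj_incl N (cubicField (birkhoffCoeff α σ N) (lowProj N (v s)))
    rw [← h2]
    exact h1
  have hlow : (fun s => lowProj N (v s)) = fun s => modeFlow α σ N s (lowProj N u) :=
    solution_unique (contDiff_cubicField _) (inner_birkhoff α σ N) hder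
      ((isFlow_modeFlow α σ N).deriv _) (by simp [hv.1, (isFlow_modeFlow α σ N).zero])
  have hconst : ∀ s, HasDerivAt (fun s => v s - incl N (lowProj N (v s))) 0 s := fun s => by
    have h1 := (hv.2 s).sub (((incl N).restrictScalars ℝ).hasFDerivAt.comp_hasDerivAt s (hder s))
    rw [field_eq] at h1
    have h2 : (0 : L2) = incl N (cubicField (birkhoffCoeff α σ N) (lowProj N (v s))) -
      incl N (cubicField (birkhoffCoeff α σ N) (lowProj N (v s))) := (sub_self _).symm
    rw [h2]
    exact h1
  have h0 := is_const_of_deriv_eq_zero (fun s => (hconst s).differentiableAt)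
    (fun s => (hconst s).deriv) t 0
  have hlt := congrFun hlow t
  simp only [hv.1] at h0 hlt
  rw [hlt] at h0
  rw [map_sub, ← add_sub_assoc, add_sub_right_comm, ← h0, sub_add_cancel]

theorem flow_eq (α σ : ℝ) (N : ℕ) (t : ℝ) (u : L2) :
    flow α σ N t u = u + incl N (modeFlow α σ N t (lowProj N u) - lowProj N u) :=
  (Classical.epsilon_spec (p := IsSolution α σ N u) ⟨_, isSolution_incl α σ N u⟩).eq t

theorem lowProj_flow (α σ : ℝ) (N : ℕ) (t : ℝ) (u : L2) :
    lowProj N (flow α σ N t u) = modeFlow α σ N t (lowProj N u) := by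
  rw [flow_eq, map_add, lowProj_incl, add_sub_cancel]

theorem coef_flow_notMem (α σ : ℝ) (N : ℕ) (t : ℝ) (u : L2) {n : ℤ} (hn : n ∉ freq N) :
    coef n (flow α σ N t u) = coef n u := by
  rw [flow_eq, map_add, coef_incl_notMem N _ hn, add_zero]

theorem flow_neg_flow (α σ : ℝ) (N : ℕ) (t : ℝ) (u : L2) :
    flow α σ N (-t) (flow α σ N t u) = u := by
  rw [flow_eq, lowProj_flow, modeFlow_neg_comp, flow_eq, add_assoc, ← map_add]
  simp

theorem flow_flow_neg (α σ : ℝ) (N : ℕ) (t : ℝ) (u : L2) :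
    flow α σ N t (flow α σ N (-t) u) = u := by
  simpa using flow_neg_flow α σ N (-t) u

theorem continuous_flow (α σ : ℝ) (N : ℕ) (t : ℝ) : Continuous (flow α σ N t) := by
  have : flow α σ N t = fun u => u + incl N (modeFlow α σ N t (lowProj N u) - lowProj N u) :=
    funext (flow_eq α σ N t)
  rw [this]
  have h := (continuous_modeFlow α σ N t).comp (lowProj N).continuous
  exact continuous_id.add ((incl N).continuous.comp (h.sub (lowProj N).continuous))

theorem measurable_flow (α σ : ℝ) (N : ℕ) (t : ℝ) : Measurable (flow α σ N t) :=
  (continuous_flow α σ N t).measurable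

theorem image_flow (α σ : ℝ) (N : ℕ) (t : ℝ) (A : Set L2) :
    flow α σ N t '' A = flow α σ N (-t) ⁻¹' A :=
  congrFun (Set.image_eq_preimage_of_inverse (flow_neg_flow α σ N t) (flow_flow_neg α σ N t)) A

theorem norm_flow (α σ : ℝ) (N : ℕ) (t : ℝ) (u : L2) : ‖flow α σ N t u‖ = ‖u‖ := by
  have h1 := (hasSum_norm_coef_sq (flow α σ N t u)).sub (hasSum_norm_coef_sq u)
  have h2 := hasSum_sum_of_ne_finset_zero (L := SummationFilter.unconditional ℤ) (s := freq N)
    (f := fun n => ‖coef n (flow α σ N t u)‖ ^ 2 - ‖coef n u‖ ^ 2)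
    (fun n hn => by simp [coef_flow_notMem α σ N t u hn])
  have h3 := h1.unique h2
  have h4 : ∀ v : L2, ∑ n ∈ freq N, ‖coef n v‖ ^ 2 = ‖lowProj N v‖ ^ 2 := fun v => by
    rw [EuclideanSpace.norm_sq_eq, ← Finset.sum_coe_sort]
    rfl
  rw [Finset.sum_sub_distrib, h4, h4, lowProj_flow, norm_modeFlow, sub_self, sub_eq_zero] at h3
  exact (sq_eq_sq₀ (norm_nonneg _) (norm_nonneg _)).1 h3

end FlowL2

/-! ### Product measures -/

theorem pi_withDensity {ι X : Type*} [Fintype ι] [MeasurableSpace X] (μ : Measure X)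
    [IsProbabilityMeasure μ] {f : X → ℝ≥0∞} (hf : Measurable f) [SigmaFinite (μ.withDensity f)] :
    Measure.pi (fun _ : ι => μ.withDensity f) =
      (Measure.pi fun _ : ι => μ).withDensity fun x => ∏ i, f (x i) := by
  refine Measure.pi_eq fun s hs => ?_
  rw [withDensity_apply _ (MeasurableSet.univ_pi hs), ← lintegral_indicator (MeasurableSet.univ_pi hs)]
  have h1 : ∀ x : ι → X, (Set.univ.pi s).indicator (fun x => ∏ i, f (x i)) x =
      ∏ i, (s i).indicator f (x i) := fun x => by
    by_cases hx : x ∈ Set.univ.pi s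
    · rw [Set.indicator_of_mem hx]
      exact Finset.prod_congr rfl fun i _ => (Set.indicator_of_mem (hx i trivial) f).symm
    · rw [Set.indicator_of_notMem hx]
      simp only [Set.mem_pi, Set.mem_univ, true_imp_iff, not_forall] at hx
      obtain ⟨i, hi⟩ := hx
      exact (Finset.prod_eq_zero (Finset.mem_univ i) (Set.indicator_of_notMem hi f)).symm
  simp only [h1]
  have hm : ∀ i, Measurable ((s i).indicator f) := fun i => hf.indicator (hs i)
  have hind : iIndepFun (fun i (x : ι → X) => (s i).indicator f (x i)) (Measure.pi fun _ => μ) :=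
    iIndepFun_pi (X := fun i => (s i).indicator f) fun i => (hm i).aemeasurable
  rw [lintegral_prod_eq_prod_lintegral_of_indepFun Finset.univ _ hind
    (fun i => (hm i).comp (measurable_pi_apply i))]
  refine Finset.prod_congr rfl fun i _ => ?_
  rw [(measurePreserving_eval (fun _ : ι => μ) i).lintegral_comp (hm i),
    lintegral_indicator (hs i), withDensity_apply _ (hs i)]

theorem infinitePi_eq_map_updateFinset {ι X : Type*} [DecidableEq ι] [MeasurableSpace X]
    (μ : Measure X) [IsProbabilityMeasure μ] (s : Finset ι) :
    Measure.infinitePi (fun _ : ι => μ) =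
      ((Measure.pi fun _ : s => μ).prod (Measure.infinitePi fun _ : ι => μ)).map
        fun p => Function.updateFinset p.2 s p.1 := by
  have hmeas : Measurable fun p : (s → X) × (ι → X) => Function.updateFinset p.2 s p.1 := by
    refine measurable_pi_lambda _ fun i => ?_
    by_cases hi : i ∈ s
    · simp only [Function.updateFinset, hi, dite_true]
      exact (measurable_pi_apply _).comp measurable_fst
    · simp only [Function.updateFinset, hi, dite_false]
      exact (measurable_pi_apply _).comp measurable_snd
  symm
  refine Measure.eq_infinitePi (fun _ => μ) fun s' t ht => ?_
  rw [Measure.map_apply hmeas (.pi s'.countable_toSet fun i _ => ht i)]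
  have hpre : (fun p : (s → X) × (ι → X) => Function.updateFinset p.2 s p.1) ⁻¹' (s' : Set ι).pi t =
      (Set.univ.pi fun i : s => if (i : ι) ∈ s' then t i else Set.univ) ×ˢ
        (((s' \ s : Finset ι) : Set ι).pi t) := by
    ext ⟨x, g⟩
    simp only [Set.mem_preimage, Set.mem_pi, Finset.mem_coe, Set.mem_prod, Set.mem_univ,
      true_imp_iff, Finset.mem_sdiff]
    constructor
    · intro h
      refine ⟨fun i => ?_, fun i hi => ?_⟩
      · split_ifs with hi
        · have := h i hi
          simpa [Function.updateFinset] using this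
        · trivial
      · have := h i hi.1
        simpa [Function.updateFinset, hi.2] using this
    · rintro ⟨h1, h2⟩ i hi
      by_cases his : i ∈ s
      · have := h1 ⟨i, his⟩
        simpa [Function.updateFinset, his, hi] using this
      · have := h2 i ⟨hi, his⟩
        simpa [Function.updateFinset, his] using this
  rw [hpre, Measure.prod_prod, Measure.pi_pi, Measure.infinitePi_pi _ (fun i _ => ht i)]
  have h1 : ∀ i : s, μ (if (i : ι) ∈ s' then t i else Set.univ) =
      if (i : ι) ∈ s' then μ (t i) else 1 := fun i => by
    split_ifs <;> simp
  simp only [h1]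
  rw [Finset.prod_coe_sort s (fun i => if i ∈ s' then μ (t i) else 1), ← Finset.prod_filter,
    Finset.filter_mem_eq_inter, Finset.inter_comm, Finset.prod_inter_mul_prod_sdiff]

/-! ### The standard complex Gaussian -/

instance : IsProbabilityMeasure stdComplexGaussian :=
  Measure.isProbabilityMeasure_map Complex.measurableEquivRealProd.symm.measurable.aemeasurable

/-- The density of the standard complex Gaussian. -/
def complexGaussianPDF (z : ℂ) : ℝ≥0∞ := ENNReal.ofReal (Real.pi⁻¹ * Real.exp (-‖z‖ ^ 2))

theorem measurable_complexGaussianPDF : Measurable complexGaussianPDF := by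
  unfold complexGaussianPDF
  fun_prop

theorem complexGaussianPDF_ne_zero (z : ℂ) : complexGaussianPDF z ≠ 0 := by
  rw [complexGaussianPDF, ne_eq, ENNReal.ofReal_eq_zero, not_le]
  have := Real.pi_pos
  positivity

theorem complexGaussianPDF_ne_top (z : ℂ) : complexGaussianPDF z ≠ ∞ := ENNReal.ofReal_ne_top

theorem stdComplexGaussian_eq : stdComplexGaussian = volume.withDensity complexGaussianPDF := by
  refine Measure.ext_of_lintegral _ fun φ hφ => ?_
  have hv : (1 / 2 : NNReal) ≠ 0 := by norm_num
  rw [stdComplexGaussian, lintegral_map hφ Complex.measurableEquivRealProd.symm.measurable,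
    gaussianReal_of_var_ne_zero _ hv,
    prod_withDensity (measurable_gaussianPDF _ _) (measurable_gaussianPDF _ _),
    lintegral_withDensity_eq_lintegral_mul _ (by fun_prop)
      (g := fun p => φ (Complex.measurableEquivRealProd.symm p))
      (hφ.comp Complex.measurableEquivRealProd.symm.measurable),
    lintegral_withDensity_eq_lintegral_mul _ measurable_complexGaussianPDF hφ,
    ← Complex.volume_preserving_equiv_real_prod.symm.lintegral_comp
      (measurable_complexGaussianPDF.mul hφ)]
  refine lintegral_congr fun p => ?_
  simp only [Pi.mul_apply]
  congr 1
  rw [gaussianPDF, gaussianPDF, complexGaussianPDF, ← ENNReal.ofReal_mul (gaussianPDFReal_nonneg _ _ _)]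
  congr 1
  rw [gaussianPDFReal, gaussianPDFReal, Complex.sq_norm, Complex.normSq_apply]
  have h1 : (2 * Real.pi * ((1 / 2 : NNReal) : ℝ)) = Real.pi := by
    push_cast
    ring
  have h2 : (2 * ((1 / 2 : NNReal) : ℝ)) = 1 := by
    push_cast
    ring
  rw [h1, h2, mul_mul_mul_comm, ← mul_inv, Real.mul_self_sqrt Real.pi_pos.le, ← Real.exp_add]
  congr 2
  change _ = -(p.1 * p.1 + p.2 * p.2)
  ring

theorem pi_stdComplexGaussian (ι : Type*) [Fintype ι] :
    Measure.pi (fun _ : ι => stdComplexGaussian) =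
      (volume : Measure (ι → ℂ)).withDensity fun x => ∏ i, complexGaussianPDF (x i) := by
  have hv : (volume : Measure ℂ) =
      stdComplexGaussian.withDensity fun z => (complexGaussianPDF z)⁻¹ := by
    rw [stdComplexGaussian_eq]
    exact (withDensity_inv_same measurable_complexGaussianPDF
      (ae_of_all _ complexGaussianPDF_ne_zero) (ae_of_all _ complexGaussianPDF_ne_top)).symm
  have hm : Measurable fun x : ι → ℂ => ∏ i, complexGaussianPDF (x i) :=
    Finset.measurable_fun_prod _ fun i _ => measurable_complexGaussianPDF.comp (measurable_pi_apply i)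
  have hs : SigmaFinite (stdComplexGaussian.withDensity fun z => (complexGaussianPDF z)⁻¹) := by
    rw [← hv]; infer_instance
  have h1 : (volume : Measure (ι → ℂ)) = (Measure.pi fun _ : ι => stdComplexGaussian).withDensity
      fun x => ∏ i, (complexGaussianPDF (x i))⁻¹ := by
    rw [← pi_withDensity stdComplexGaussian (f := fun z => (complexGaussianPDF z)⁻¹)
      measurable_complexGaussianPDF.inv, volume_pi]
    simp only [← hv]
  rw [h1]
  have h2 : (fun x : ι → ℂ => ∏ i, (complexGaussianPDF (x i))⁻¹) =
      fun x => (∏ i, complexGaussianPDF (x i))⁻¹ := by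
    ext x
    rw [ENNReal.prod_inv_distrib]
    intro i _ j _ _
    exact Or.inl (complexGaussianPDF_ne_zero _)
  rw [h2]
  have h3 := withDensity_inv_same (μ := Measure.pi fun _ : ι => stdComplexGaussian) hm.inv
    (ae_of_all _ fun x => ENNReal.inv_ne_zero.2
      (ENNReal.prod_ne_top fun i _ => complexGaussianPDF_ne_top _))
    (ae_of_all _ fun x => ENNReal.inv_ne_top.2
      (Finset.prod_ne_zero_iff.2 fun i _ => complexGaussianPDF_ne_zero _))
  simp only [Pi.inv_apply, inv_inv] at h3
  exact h3.symm

theorem lintegral_exp_mul_sq_stdComplexGaussian {a : ℝ} (ha : a < 1) :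
    ∫⁻ z, ENNReal.ofReal (Real.exp (a * ‖z‖ ^ 2)) ∂stdComplexGaussian =
      ENNReal.ofReal (1 - a)⁻¹ := by
  have h1a : 0 < 1 - a := by linarith
  rw [stdComplexGaussian_eq, lintegral_withDensity_eq_lintegral_mul _ measurable_complexGaussianPDF
    (by fun_prop)]
  have h1 : ∀ z : ℂ, (complexGaussianPDF * fun z : ℂ => ENNReal.ofReal (Real.exp (a * ‖z‖ ^ 2))) z =
      ENNReal.ofReal (Real.pi⁻¹ * Real.exp (-(1 - a) * ‖z‖ ^ (2 : ℝ))) := fun z => by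
    rw [Pi.mul_apply, complexGaussianPDF, ← ENNReal.ofReal_mul (by have := Real.pi_pos; positivity),
      mul_assoc, ← Real.exp_add, Real.rpow_two]
    ring_nf
  simp only [h1]
  have h2 : ∫ z : ℂ, Real.pi⁻¹ * Real.exp (-(1 - a) * ‖z‖ ^ (2 : ℝ)) = (1 - a)⁻¹ := by
    rw [integral_const_mul, Complex.integral_exp_neg_mul_rpow (by norm_num) h1a]
    norm_num
    rw [Real.rpow_neg_one]
  have hi : Integrable fun z : ℂ => Real.pi⁻¹ * Real.exp (-(1 - a) * ‖z‖ ^ (2 : ℝ)) :=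
    Integrable.of_integral_ne_zero (by rw [h2]; positivity)
  rw [← ofReal_integral_eq_lintegral_ofReal hi (ae_of_all _ fun z => by
    have := Real.pi_pos; positivity), h2]

theorem lintegral_exp_mul_sq_stdComplexGaussian_le {a : ℝ} (h0 : 0 ≤ a) (ha : a ≤ 1 / 2) :
    ∫⁻ z, ENNReal.ofReal (Real.exp (a * ‖z‖ ^ 2)) ∂stdComplexGaussian ≤
      ENNReal.ofReal (Real.exp (2 * a)) := by
  rw [lintegral_exp_mul_sq_stdComplexGaussian (by linarith)]
  apply ENNReal.ofReal_le_ofReal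
  rw [inv_le_comm₀ (by linarith) (Real.exp_pos _), ← Real.exp_neg]
  have h1 : Real.exp (-(2 * a)) * (1 + 2 * a) ≤ 1 := by
    calc Real.exp (-(2 * a)) * (1 + 2 * a) ≤ Real.exp (-(2 * a)) * Real.exp (2 * a) := by
          gcongr
          rw [add_comm]; exact Real.add_one_le_exp _
      _ = 1 := by rw [← Real.exp_add]; simp
  have h2 : Real.exp (-(2 * a)) ≤ 1 / (1 + 2 * a) := by
    rw [le_div_iff₀ (by linarith)]; exact h1
  refine h2.trans ?_
  rw [div_le_iff₀ (by linarith)]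
  nlinarith

theorem lintegral_sq_stdComplexGaussian_lt_top :
    ∫⁻ z, ENNReal.ofReal (‖z‖ ^ 2) ∂stdComplexGaussian < ∞ := by
  refine lt_of_le_of_lt ?_ (ENNReal.mul_lt_top (ENNReal.ofReal_lt_top (r := 2))
    (ENNReal.ofReal_lt_top (r := (1 - 1 / 2 : ℝ)⁻¹)))
  rw [← lintegral_exp_mul_sq_stdComplexGaussian (a := 1 / 2) (by norm_num),
    ← lintegral_const_mul _ (by fun_prop)]
  refine lintegral_mono fun z => ?_
  rw [← ENNReal.ofReal_mul (by norm_num)]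
  apply ENNReal.ofReal_le_ofReal
  have := Real.add_one_le_exp (1 / 2 * ‖z‖ ^ 2)
  linarith

/-! ### The random Fourier series -/

/-- The law of the Gaussian coefficients. -/
abbrev noise : Measure (ℤ → ℂ) := Measure.infinitePi fun _ : ℤ => stdComplexGaussian

theorem lintegral_exp_sum_noise_le (F : Finset ℤ) {b : ℤ → ℝ} (h0 : ∀ n ∈ F, 0 ≤ b n)
    (hb : ∀ n ∈ F, b n ≤ 1 / 2) :
    ∫⁻ g, ENNReal.ofReal (Real.exp (∑ n ∈ F, b n * ‖g n‖ ^ 2)) ∂noise ≤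
      ENNReal.ofReal (Real.exp (2 * ∑ n ∈ F, b n)) := by
  have hm : ∀ n : ℤ, Measurable fun z : ℂ => ENNReal.ofReal (Real.exp (b n * ‖z‖ ^ 2)) := fun n => by
    fun_prop
  have hind : iIndepFun (fun n (g : ℤ → ℂ) => ENNReal.ofReal (Real.exp (b n * ‖g n‖ ^ 2))) noise :=
    iIndepFun_infinitePi (P := fun _ : ℤ => stdComplexGaussian)
      (X := fun n z => ENNReal.ofReal (Real.exp (b n * ‖z‖ ^ 2))) hm
  simp only [Real.exp_sum, Finset.mul_sum]
  simp only [ENNReal.ofReal_prod_of_nonneg fun _ _ => (Real.exp_pos _).le]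
  rw [lintegral_prod_eq_prod_lintegral_of_indepFun F _ hind
    (fun n => (hm n).comp (measurable_pi_apply n))]
  refine Finset.prod_le_prod' fun n hn => ?_
  rw [(measurePreserving_eval_infinitePi (fun _ : ℤ => stdComplexGaussian) n).lintegral_comp (hm n)]
  exact lintegral_exp_mul_sq_stdComplexGaussian_le (h0 n hn) (hb n hn)

/-- The Fourier coefficients of the random series. -/
def scaled (α : ℝ) (g : ℤ → ℂ) (n : ℤ) : ℂ := g n / (Real.sqrt (prec α n) : ℂ)

theorem norm_scaled_sq (α : ℝ) (g : ℤ → ℂ) (n : ℤ) :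
    ‖scaled α g n‖ ^ 2 = ‖g n‖ ^ 2 / prec α n := by
  rw [scaled, norm_div, div_pow, Complex.norm_real, Real.norm_of_nonneg (Real.sqrt_nonneg _),
    Real.sq_sqrt (prec_pos α n).le]

theorem ae_summable_scaled {α : ℝ} (hα : 3 / 4 < α) :
    ∀ᵐ g ∂noise, Summable fun n => ‖scaled α g n‖ ^ 2 := by
  have hm : ∀ n : ℤ, Measurable fun g : ℤ → ℂ => ENNReal.ofReal (‖g n‖ ^ 2) := fun n => by
    fun_prop
  have hfin : ∫⁻ g, ∑' n : ℤ, ENNReal.ofReal (‖scaled α g n‖ ^ 2) ∂noise ≠ ∞ := by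
    have h1 : ∀ (g : ℤ → ℂ) (n : ℤ), ENNReal.ofReal (‖scaled α g n‖ ^ 2) =
        ENNReal.ofReal (‖g n‖ ^ 2) * ENNReal.ofReal (prec α n)⁻¹ := fun g n => by
      rw [norm_scaled_sq, div_eq_mul_inv, ENNReal.ofReal_mul (by positivity)]
    simp only [h1]
    rw [lintegral_tsum fun n => ((hm n).mul_const _).aemeasurable]
    have h2 : ∀ n : ℤ, ∫⁻ g, ENNReal.ofReal (‖g n‖ ^ 2) * ENNReal.ofReal (prec α n)⁻¹ ∂noise =
        (∫⁻ z, ENNReal.ofReal (‖z‖ ^ 2) ∂stdComplexGaussian) * ENNReal.ofReal (prec α n)⁻¹ :=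
      fun n => by
      rw [lintegral_mul_const _ (hm n)]
      congr 1
      exact (measurePreserving_eval_infinitePi (fun _ : ℤ => stdComplexGaussian) n).lintegral_comp
        (f := fun z : ℂ => ENNReal.ofReal (‖z‖ ^ 2)) (by fun_prop)
    simp only [h2]
    rw [ENNReal.tsum_mul_left]
    refine ENNReal.mul_ne_top lintegral_sq_stdComplexGaussian_lt_top.ne ?_
    exact (summable_inv_prec hα).tsum_ofReal_ne_top
  have hae := ae_lt_top' (AEMeasurable.tsum fun n => Measurable.aemeasurable (by
    unfold scaled
    fun_prop)) hfin
  filter_upwards [hae] with g hg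
  have := ENNReal.summable_toReal hg.ne
  refine this.congr fun n => ?_
  rw [ENNReal.toReal_ofReal (by positivity)]

theorem hasSum_fourierSeries {α : ℝ} {g : ℤ → ℂ} (hg : Summable fun n => ‖scaled α g n‖ ^ 2) :
    HasSum (fun n => scaled α g n • (fourierLp 2 n : L2)) (fourierSeries α g) := by
  have hmem : Memℓp (scaled α g) 2 := by
    refine memℓp_gen ?_
    simpa using hg
  have h := (fourierBasis (T := 2 * Real.pi)).hasSum_repr_symm (⟨scaled α g, hmem⟩ : lp (fun _ : ℤ => ℂ) 2)
  rw [coe_fourierBasis] at h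
  exact h.summable.hasSum

theorem coef_fourierSeries {α : ℝ} {g : ℤ → ℂ} (hg : Summable fun n => ‖scaled α g n‖ ^ 2) (n : ℤ) :
    coef n (fourierSeries α g) = scaled α g n := by
  have h := (coef n).hasSum (hasSum_fourierSeries hg)
  have h2 : HasSum (fun m => coef n (scaled α g m • (fourierLp 2 m : L2))) (scaled α g n) := by
    have := hasSum_ite_eq n (scaled α g n)
    convert this using 2 with m
    rw [map_smul, coef_fourierLp, smul_eq_mul, mul_ite, mul_one, mul_zero]
    by_cases h : m = n
    · simp [h]
    · simp [h, Ne.symm h]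
  exact h.unique h2

theorem aemeasurable_fourierSeries {α : ℝ} (hα : 3 / 4 < α) :
    AEMeasurable (fourierSeries α) noise := by
  refine aemeasurable_of_tendsto_metrizable_ae Filter.atTop
    (f := fun (F : Finset ℤ) g => ∑ n ∈ F, scaled α g n • (fourierLp 2 n : L2)) (fun F => ?_) ?_
  · refine (Continuous.measurable ?_).aemeasurable
    unfold scaled
    refine continuous_finsetSum _ fun n _ => ?_
    exact ((continuous_apply n).div_const _).smul continuous_const
  · filter_upwards [ae_summable_scaled hα] with g hg using hasSum_fourierSeries hg

theorem isProbabilityMeasure_gaussian {α : ℝ} (hα : 3 / 4 < α) :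
    IsProbabilityMeasure (gaussian α) :=
  Measure.isProbabilityMeasure_map (aemeasurable_fourierSeries hα)

theorem lintegral_gaussian {α : ℝ} (hα : 3 / 4 < α) {H : L2 → ℝ≥0∞} (hH : Measurable H) :
    ∫⁻ u, H u ∂gaussian α = ∫⁻ g, H (fourierSeries α g) ∂noise :=
  lintegral_map' hH.aemeasurable (aemeasurable_fourierSeries hα)

theorem lintegral_exp_sum_gaussian_le {α : ℝ} (hα : 3 / 4 < α) (F : Finset ℤ) {b : ℤ → ℝ}
    (h0 : ∀ n ∈ F, 0 ≤ b n) (hb : ∀ n ∈ F, b n ≤ prec α n / 2) :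
    ∫⁻ u, ENNReal.ofReal (Real.exp (∑ n ∈ F, b n * ‖coef n u‖ ^ 2)) ∂gaussian α ≤
      ENNReal.ofReal (Real.exp (2 * ∑ n ∈ F, b n / prec α n)) := by
  have hc : Continuous fun u : L2 => Real.exp (∑ n ∈ F, b n * ‖coef n u‖ ^ 2) := by fun_prop
  rw [lintegral_gaussian hα hc.measurable.ennreal_ofReal]
  refine le_trans (le_of_eq ?_) (lintegral_exp_sum_noise_le F (b := fun n => b n / prec α n)
    (fun n hn => div_nonneg (h0 n hn) (prec_pos α n).le) (fun n hn => by
      rw [div_le_iff₀ (prec_pos α n)]; linarith [hb n hn]))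
  refine lintegral_congr_ae ?_
  filter_upwards [ae_summable_scaled hα] with g hg
  congr 2
  refine Finset.sum_congr rfl fun n _ => ?_
  rw [coef_fourierSeries hg, norm_scaled_sq]
  ring

/-! ### Change of variables for the Gaussian measure -/

section ChangeOfVariables

/-- The diagonal scaling that turns white noise into the low modes of the Gaussian measure. -/
def scaleEquiv (α : ℝ) (N : ℕ) : (freq N → ℂ) ≃L[ℝ] Modes N :=
  LinearEquiv.toContinuousLinearEquiv
    { toFun := fun x => WithLp.toLp 2 fun n => x n / (Real.sqrt (prec α n) : ℂ)
      map_add' := fun x y => by ext n; simp [add_div]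
      map_smul' := fun c x => by ext n; simp [mul_div_assoc]
      invFun := fun y n => y n * (Real.sqrt (prec α n) : ℂ)
      left_inv := fun x => by
        ext n
        have : (Real.sqrt (prec α n) : ℂ) ≠ 0 := by
          exact_mod_cast (Real.sqrt_pos.2 (prec_pos α n)).ne'
        simp [this]
      right_inv := fun y => by
        ext n
        have : (Real.sqrt (prec α n) : ℂ) ≠ 0 := by
          exact_mod_cast (Real.sqrt_pos.2 (prec_pos α n)).ne'
        simp [this] }

theorem scaleEquiv_apply (α : ℝ) (N : ℕ) (x : freq N → ℂ) (n : freq N) :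
    scaleEquiv α N x n = x n / (Real.sqrt (prec α n) : ℂ) := rfl

/-- The reference Haar measure on the low modes. -/
def modeHaar (α : ℝ) (N : ℕ) : Measure (Modes N) :=
  (volume : Measure (freq N → ℂ)).map (scaleEquiv α N)

instance (α : ℝ) (N : ℕ) : (modeHaar α N).IsAddHaarMeasure :=
  (scaleEquiv α N).isAddHaarMeasure_map _

theorem modeEnergy_scaleEquiv (α : ℝ) (N : ℕ) (x : freq N → ℂ) :
    modeEnergy α N (scaleEquiv α N x) = ∑ n, ‖x n‖ ^ 2 := by
  refine Finset.sum_congr rfl fun n _ => ?_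
  rw [scaleEquiv_apply, norm_div, div_pow, Complex.norm_real,
    Real.norm_of_nonneg (Real.sqrt_nonneg _), Real.sq_sqrt (prec_pos α n).le]
  field_simp [(prec_pos α n).ne']

theorem prod_complexGaussianPDF (α : ℝ) (N : ℕ) (x : freq N → ℂ) :
    ∏ n, complexGaussianPDF (x n) = ENNReal.ofReal (Real.pi⁻¹ ^ Fintype.card (freq N)) *
      ENNReal.ofReal (Real.exp (-modeEnergy α N (scaleEquiv α N x))) := by
  have hpi := Real.pi_pos
  unfold complexGaussianPDF
  rw [← ENNReal.ofReal_prod_of_nonneg (fun _ _ => by positivity), Finset.prod_mul_distrib,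
    ← Real.exp_sum, ENNReal.ofReal_mul (by positivity), modeEnergy_scaleEquiv,
    Finset.sum_neg_distrib]
  simp

/-- The random series with its low modes removed. -/
def highSeries (α : ℝ) (N : ℕ) (g : ℤ → ℂ) : L2 :=
  fourierSeries α (Function.updateFinset g (freq N) 0)

theorem summable_scaled_updateFinset {α : ℝ} (N : ℕ) {g : ℤ → ℂ}
    (hg : Summable fun n => ‖scaled α g n‖ ^ 2) (x : freq N → ℂ) :
    Summable fun n => ‖scaled α (Function.updateFinset g (freq N) x) n‖ ^ 2 := by
  refine hg.congr_cofinite ?_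
  filter_upwards [(freq N).finite_toSet.compl_mem_cofinite] with n hn
  have hn' : n ∉ freq N := hn
  simp [scaled, Function.updateFinset, hn']

theorem fourierSeries_updateFinset {α : ℝ} (N : ℕ) {g : ℤ → ℂ}
    (hg : Summable fun n => ‖scaled α g n‖ ^ 2) (x : freq N → ℂ) :
    fourierSeries α (Function.updateFinset g (freq N) x) =
      highSeries α N g + incl N (scaleEquiv α N x) := by
  refine ext_coef fun n => ?_
  rw [map_add, highSeries, coef_fourierSeries (summable_scaled_updateFinset N hg x),
    coef_fourierSeries (summable_scaled_updateFinset N hg 0)]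
  by_cases hn : n ∈ freq N
  · have := coef_incl_mem N (scaleEquiv α N x) ⟨n, hn⟩
    rw [this, scaleEquiv_apply]
    simp [scaled, Function.updateFinset, hn]
  · rw [coef_incl_notMem N _ hn]
    simp [scaled, Function.updateFinset, hn]

theorem lowProj_highSeries {α : ℝ} (N : ℕ) {g : ℤ → ℂ}
    (hg : Summable fun n => ‖scaled α g n‖ ^ 2) : lowProj N (highSeries α N g) = 0 := by
  ext n
  rw [lowProj_apply, highSeries, coef_fourierSeries (summable_scaled_updateFinset N hg 0)]
  simp [scaled, Function.updateFinset]

theorem lintegral_gaussian_disintegration {α : ℝ} (hα : 3 / 4 < α) (N : ℕ) {H : L2 → ℝ≥0∞}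
    (hH : Measurable H) : ∫⁻ u, H u ∂gaussian α =
      ∫⁻ g, ENNReal.ofReal (Real.pi⁻¹ ^ Fintype.card (freq N)) *
        ∫⁻ y, H (highSeries α N g + incl N y) * ENNReal.ofReal (Real.exp (-modeEnergy α N y))
          ∂modeHaar α N ∂noise := by
  have hmeas : Measurable fun p : (freq N → ℂ) × (ℤ → ℂ) =>
      Function.updateFinset p.2 (freq N) p.1 := by
    refine measurable_pi_lambda _ fun i => ?_
    by_cases hi : i ∈ freq N
    · simp only [Function.updateFinset, hi, dite_true]
      exact (measurable_pi_apply _).comp measurable_fst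
    · simp only [Function.updateFinset, hi, dite_false]
      exact (measurable_pi_apply _).comp measurable_snd
  have hae := (hH.comp_aemeasurable (aemeasurable_fourierSeries hα))
  have hnoise := infinitePi_eq_map_updateFinset stdComplexGaussian (freq N)
  have h1 : AEMeasurable (fun p : (freq N → ℂ) × (ℤ → ℂ) =>
      H (fourierSeries α (Function.updateFinset p.2 (freq N) p.1)))
      ((Measure.pi fun _ : freq N => stdComplexGaussian).prod noise) := by
    have h2 : AEMeasurable (H ∘ fourierSeries α)
        (((Measure.pi fun _ : freq N => stdComplexGaussian).prod noise).map
          fun p => Function.updateFinset p.2 (freq N) p.1) := by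
      rw [← hnoise]; exact hae
    exact h2.comp_measurable hmeas
  have h2 : AEMeasurable (fun g => H (fourierSeries α g))
      (((Measure.pi fun _ : freq N => stdComplexGaussian).prod noise).map
        fun p => Function.updateFinset p.2 (freq N) p.1) := by
    rw [← hnoise]; exact hae
  rw [lintegral_gaussian hα hH]
  conv_lhs => rw [noise, hnoise]
  rw [lintegral_map' h2 hmeas.aemeasurable, lintegral_prod_symm _ h1]
  refine lintegral_congr_ae ?_
  filter_upwards [ae_summable_scaled hα] with g hg
  simp only [fourierSeries_updateFinset N hg]
  have hHm : Measurable fun y : Modes N => H (highSeries α N g + incl N y) :=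
    hH.comp ((continuous_const.add (incl N).continuous).measurable)
  have hsm : Measurable (scaleEquiv α N) := (scaleEquiv α N).continuous.measurable
  have hEm : Measurable fun y : Modes N => ENNReal.ofReal (Real.exp (-modeEnergy α N y)) :=
    ((Real.continuous_exp.comp (continuous_modeEnergy α N).neg).measurable).ennreal_ofReal
  have hprod : Measurable fun y : Modes N => H (highSeries α N g + incl N y) *
    ENNReal.ofReal (Real.exp (-modeEnergy α N y)) := hHm.mul hEm
  have hpm : Measurable fun x : freq N → ℂ => ∏ n, complexGaussianPDF (x n) :=
    Finset.measurable_fun_prod _ fun i _ =>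
      measurable_complexGaussianPDF.comp (measurable_pi_apply i)
  rw [pi_stdComplexGaussian, lintegral_withDensity_eq_lintegral_mul _ hpm
    (g := fun x => H (highSeries α N g + incl N (scaleEquiv α N x))) (hHm.comp hsm),
    modeHaar, lintegral_map hprod hsm, ← lintegral_const_mul' _ _ ENNReal.ofReal_ne_top]
  refine lintegral_congr fun x => ?_
  simp only [Pi.mul_apply]
  rw [prod_complexGaussianPDF α N]
  ring

/-- The density of the transported Gaussian measure. -/
def flowDensity (α σ : ℝ) (N : ℕ) (t : ℝ) (u : L2) : ℝ :=
  Real.exp (modeEnergy α N (lowProj N u) - modeEnergy α N (modeFlow α σ N t (lowProj N u)))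

theorem flowDensity_pos (α σ : ℝ) (N : ℕ) (t : ℝ) (u : L2) : 0 < flowDensity α σ N t u :=
  Real.exp_pos _

theorem continuous_flowDensity (α σ : ℝ) (N : ℕ) (t : ℝ) : Continuous (flowDensity α σ N t) := by
  have h := continuous_modeEnergy α N
  exact Real.continuous_exp.comp ((h.comp (lowProj N).continuous).sub
    (h.comp ((continuous_modeFlow α σ N t).comp (lowProj N).continuous)))

theorem measurable_flowDensity (α σ : ℝ) (N : ℕ) (t : ℝ) :
    Measurable fun u => ENNReal.ofReal (flowDensity α σ N t u) :=
  (continuous_flowDensity α σ N t).measurable.ennreal_ofReal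

theorem flowDensity_mul_flowDensity_neg (α σ : ℝ) (N : ℕ) (t : ℝ) (u : L2) :
    flowDensity α σ N (-t) (flow α σ N t u) * flowDensity α σ N t u = 1 := by
  unfold flowDensity
  rw [lowProj_flow, modeFlow_neg_comp, ← Real.exp_add]
  simp

theorem lintegral_comp_flow_mul_flowDensity {α : ℝ} (hα : 3 / 4 < α) (σ : ℝ) (N : ℕ) (t : ℝ)
    {h : L2 → ℝ≥0∞} (hh : Measurable h) :
    ∫⁻ u, h (flow α σ N t u) * ENNReal.ofReal (flowDensity α σ N t u) ∂gaussian α =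
      ∫⁻ u, h u ∂gaussian α := by
  rw [lintegral_gaussian_disintegration hα N hh, lintegral_gaussian_disintegration hα N
    (H := fun u => h (flow α σ N t u) * ENNReal.ofReal (flowDensity α σ N t u))
    ((hh.comp (measurable_flow α σ N t)).mul (measurable_flowDensity α σ N t))]
  refine lintegral_congr_ae ?_
  filter_upwards [ae_summable_scaled hα] with g hg
  congr 1
  have hEm : Measurable fun y : Modes N => ENNReal.ofReal (Real.exp (-modeEnergy α N y)) :=
    ((Real.continuous_exp.comp (continuous_modeEnergy α N).neg).measurable).ennreal_ofReal
  have hHm : Measurable fun y : Modes N => h (highSeries α N g + incl N y) :=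
    hh.comp ((continuous_const.add (incl N).continuous).measurable)
  have hprod : Measurable fun y : Modes N => h (highSeries α N g + incl N y) *
    ENNReal.ofReal (Real.exp (-modeEnergy α N y)) := hHm.mul hEm
  rw [← (measurePreserving_modeFlow α σ N t (modeHaar α N)).lintegral_comp hprod]
  refine lintegral_congr fun y => ?_
  have h1 : lowProj N (highSeries α N g + incl N y) = y := by
    rw [map_add, lowProj_highSeries N hg, lowProj_incl, zero_add]
  have h2 : flow α σ N t (highSeries α N g + incl N y) =
      highSeries α N g + incl N (modeFlow α σ N t y) := by
    rw [flow_eq, h1, map_sub]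
    abel
  rw [h2, flowDensity, h1, mul_assoc, ← ENNReal.ofReal_mul (Real.exp_pos _).le, ← Real.exp_add]
  congr 3
  ring

theorem measurableSet_ball_L2 (R : ℝ) : MeasurableSet {u : L2 | ‖u‖ ≤ R} :=
  (isClosed_le continuous_norm continuous_const).measurableSet

theorem lintegral_gaussianBall_comp_flow_mul {α : ℝ} (hα : 3 / 4 < α) (σ R : ℝ) (N : ℕ) (t : ℝ)
    {h : L2 → ℝ≥0∞} (hh : Measurable h) :
    ∫⁻ u, h (flow α σ N t u) * ENNReal.ofReal (flowDensity α σ N t u) ∂gaussianBall α R =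
      ∫⁻ u, h u ∂gaussianBall α R := by
  have hB := measurableSet_ball_L2 R
  rw [gaussianBall, ← lintegral_indicator hB, ← lintegral_indicator hB,
    ← lintegral_comp_flow_mul_flowDensity hα σ N t (hh.indicator hB)]
  refine lintegral_congr fun u => ?_
  have hiff : flow α σ N t u ∈ {u : L2 | ‖u‖ ≤ R} ↔ u ∈ {u : L2 | ‖u‖ ≤ R} := by
    simp [norm_flow]
  by_cases hu : u ∈ {u : L2 | ‖u‖ ≤ R}
  · rw [Set.indicator_of_mem hu, Set.indicator_of_mem (hiff.2 hu)]
  · rw [Set.indicator_of_notMem hu, Set.indicator_of_notMem (fun h => hu (hiff.1 h)), zero_mul]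

theorem lintegral_gaussianBall_comp_flow {α : ℝ} (hα : 3 / 4 < α) (σ R : ℝ) (N : ℕ) (t : ℝ)
    {h : L2 → ℝ≥0∞} (hh : Measurable h) :
    ∫⁻ u, h (flow α σ N t u) ∂gaussianBall α R =
      ∫⁻ u, h u * ENNReal.ofReal (flowDensity α σ N (-t) u) ∂gaussianBall α R := by
  rw [← lintegral_gaussianBall_comp_flow_mul hα σ R N t
    (h := fun u => h u * ENNReal.ofReal (flowDensity α σ N (-t) u))
    (hh.mul (measurable_flowDensity α σ N (-t)))]
  refine lintegral_congr fun u => ?_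
  rw [mul_assoc, ← ENNReal.ofReal_mul (flowDensity_pos _ _ _ _ _).le,
    flowDensity_mul_flowDensity_neg, ENNReal.ofReal_one, mul_one]

theorem gaussianBall_image_flow {α : ℝ} (hα : 3 / 4 < α) (σ R : ℝ) (N : ℕ) (t : ℝ) {A : Set L2}
    (hA : MeasurableSet A) : gaussianBall α R (flow α σ N t '' A) =
      ∫⁻ u in A, ENNReal.ofReal (flowDensity α σ N t u) ∂gaussianBall α R := by
  have hm : MeasurableSet (flow α σ N t '' A) := by
    rw [image_flow]
    exact measurable_flow α σ N (-t) hA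
  rw [← lintegral_indicator_one hm, ← lintegral_gaussianBall_comp_flow_mul hα σ R N t
    (measurable_one.indicator hm), ← lintegral_indicator hA]
  refine lintegral_congr fun u => ?_
  have hiff : flow α σ N t u ∈ flow α σ N t '' A ↔ u ∈ A :=
    (Function.LeftInverse.injective (flow_neg_flow α σ N t)).mem_set_image
  by_cases hu : u ∈ A
  · rw [Set.indicator_of_mem hu, Set.indicator_of_mem (hiff.2 hu), Pi.one_apply, one_mul]
  · rw [Set.indicator_of_notMem hu, Set.indicator_of_notMem (fun h => hu (hiff.1 h)), zero_mul]

end ChangeOfVariables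

/-! ### Exponential moments of the weighted norm -/

section Moments

/-- The weighted norm squared of the low modes. -/
def lowNorm (α : ℝ) (N : ℕ) (u : L2) : ℝ := modeNorm α N (lowProj N u)

theorem lowNorm_nonneg (α : ℝ) (N : ℕ) (u : L2) : 0 ≤ lowNorm α N u := modeNorm_nonneg _ _ _

theorem continuous_lowNorm (α : ℝ) (N : ℕ) : Continuous (lowNorm α N) :=
  (continuous_modeNorm α N).comp (lowProj N).continuous

theorem lowNorm_eq (α : ℝ) (N : ℕ) (u : L2) :
    lowNorm α N u = ∑ n ∈ freq N, weight α n * ‖coef n u‖ ^ 2 := by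
  exact Finset.sum_coe_sort (freq N) fun n => weight α n * ‖coef n u‖ ^ 2

theorem sum_norm_coef_sq_le (F : Finset ℤ) (u : L2) : ∑ n ∈ F, ‖coef n u‖ ^ 2 ≤ ‖u‖ ^ 2 :=
  sum_le_hasSum F (fun _ _ => by positivity) (hasSum_norm_coef_sq u)

theorem lowNorm_mono (α : ℝ) (u : L2) : Monotone fun N => lowNorm α N u := fun M N h => by
  simp only [lowNorm_eq]
  refine Finset.sum_le_sum_of_subset_of_nonneg (fun n hn => ?_) fun n _ _ =>
    mul_nonneg (weight_pos α n).le (by positivity)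
  simp only [freq, Finset.mem_Icc] at hn ⊢
  omega

theorem sq_sub_cube_le {a μ x : ℝ} (ha : 0 < a) (hμ : 0 ≤ μ) (hx : 0 ≤ x) :
    μ * x ^ 2 - a * x ^ 3 ≤ μ ^ 3 / a ^ 2 := by
  rcases le_total (a * x) μ with h | h
  · have h1 : μ * x ^ 2 ≤ μ ^ 3 / a ^ 2 := by
      rw [le_div_iff₀ (by positivity)]
      have : (a * x) ^ 2 ≤ μ ^ 2 := pow_le_pow_left₀ (by positivity) h 2
      nlinarith
    have : 0 ≤ a * x ^ 3 := by positivity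
    linarith
  · have h1 : 0 ≤ μ ^ 3 / a ^ 2 := by positivity
    nlinarith [mul_le_mul_of_nonneg_right h (sq_nonneg x)]

theorem moment_exponent_le {a b lam x : ℝ} (ha : 0 < a) (hb : 0 ≤ b) (hl : 0 ≤ lam) (hx : 0 ≤ x) :
    lam * (x + 1) ^ 2 - a * x ^ 3 + b * x ^ 2 ≤
      ((32 + 4 * (b + 1) ^ 3) / a ^ 2 + 4) * (1 + lam ^ 3) + -x := by
  have h1 := sq_sub_cube_le ha (by positivity : 0 ≤ 2 * lam + b + 1) hx
  have h2 : (2 * lam + b + 1) ^ 3 ≤ (32 + 4 * (b + 1) ^ 3) * (1 + lam ^ 3) := by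
    have h3 : (2 * lam + (b + 1)) ^ 3 ≤ 4 * ((2 * lam) ^ 3 + (b + 1) ^ 3) := by
      have := mul_nonneg (by positivity : 0 ≤ 2 * lam + (b + 1)) (sq_nonneg (2 * lam - (b + 1)))
      nlinarith
    have h4 : 0 ≤ (b + 1) ^ 3 * lam ^ 3 := by positivity
    rw [add_assoc]
    nlinarith
  have h5 : (2 * lam + b + 1) ^ 3 / a ^ 2 ≤ (32 + 4 * (b + 1) ^ 3) / a ^ 2 * (1 + lam ^ 3) := by
    rw [div_mul_eq_mul_div]
    gcongr
  have h6 : lam ≤ 1 + lam ^ 3 := by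
    rcases le_total lam 1 with h | h
    · have : 0 ≤ lam ^ 3 := by positivity
      linarith
    · nlinarith [mul_nonneg hl (sub_nonneg.2 h), mul_nonneg (mul_nonneg hl hl) (sub_nonneg.2 h)]
  have h7 : lam * (x + 1) ^ 2 ≤ lam * (2 * x ^ 2 + 2) := by
    gcongr
    nlinarith [sq_nonneg (x - 1)]
  have h8 : 0 ≤ lam ^ 3 := by positivity
  nlinarith [sq_nonneg (x - 1)]

/-- On the ball of radius `R`, the exponential is controlled on the level set `⌊A⌋ = k` by the
high frequencies only. -/
theorem exp_lowNorm_sq_le {α R lam : ℝ} (hR : 0 < R) (hl : 0 ≤ lam) (N : ℕ) {u : L2}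
    (hu : ‖u‖ ≤ R) (k : ℕ) (hk : k = ⌊lowNorm α N u⌋₊) :
    lam * lowNorm α N u ^ 2 ≤ lam * (k + 1 : ℝ) ^ 2 - (k : ℝ) ^ 3 / (16 * R ^ 4) +
      ∑ n ∈ (freq N).filter (fun n => k / (2 * R ^ 2) < weight α n),
        (k : ℝ) ^ 2 / (8 * R ^ 4) * weight α n * ‖coef n u‖ ^ 2 := by
  have h0 := lowNorm_nonneg α N u
  have hk1 : (k : ℝ) ≤ lowNorm α N u := hk ▸ Nat.floor_le h0
  have hk2 : lowNorm α N u ≤ k + 1 := hk ▸ (Nat.lt_floor_add_one _).le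
  have h1 : lam * lowNorm α N u ^ 2 ≤ lam * (k + 1 : ℝ) ^ 2 := by gcongr
  have h2 := lowNorm_eq α N u
  rw [← Finset.sum_filter_add_sum_filter_not _ (fun n => k / (2 * R ^ 2) < weight α n)] at h2
  have h3 : ∑ n ∈ (freq N).filter (fun n => ¬ (k / (2 * R ^ 2) < weight α n)),
      weight α n * ‖coef n u‖ ^ 2 ≤ k / 2 := by
    calc _ ≤ ∑ n ∈ (freq N).filter (fun n => ¬ (k / (2 * R ^ 2) < weight α n)),
          k / (2 * R ^ 2) * ‖coef n u‖ ^ 2 := by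
          refine Finset.sum_le_sum fun n hn => ?_
          have := not_lt.1 (Finset.mem_filter.1 hn).2
          gcongr
      _ ≤ k / (2 * R ^ 2) * R ^ 2 := by
          rw [← Finset.mul_sum]
          gcongr
          exact (sum_norm_coef_sq_le _ u).trans (pow_le_pow_left₀ (norm_nonneg _) hu 2)
      _ = k / 2 := by field_simp
  have h4 : (k : ℝ) ^ 2 / (8 * R ^ 4) * (k / 2) ≤ (k : ℝ) ^ 2 / (8 * R ^ 4) *
      ∑ n ∈ (freq N).filter (fun n => k / (2 * R ^ 2) < weight α n),
        weight α n * ‖coef n u‖ ^ 2 := by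
    gcongr
    linarith
  rw [Finset.mul_sum] at h4
  simp only [← mul_assoc] at h4
  have h5 : (k : ℝ) ^ 2 / (8 * R ^ 4) * (k / 2) = (k : ℝ) ^ 3 / (16 * R ^ 4) := by
    ring
  rw [h5] at h4
  linarith

theorem lintegral_exp_high_le {α R : ℝ} (hα : 3 / 4 < α) (hR : 0 < R) (N k : ℕ) :
    ∫⁻ u, ENNReal.ofReal (Real.exp
      (∑ n ∈ (freq N).filter (fun n => k / (2 * R ^ 2) < weight α n),
        (k : ℝ) ^ 2 / (8 * R ^ 4) * weight α n * ‖coef n u‖ ^ 2)) ∂gaussian α ≤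
      ENNReal.ofReal (Real.exp (weightSum α / (4 * R ^ 4) * (k : ℝ) ^ 2)) := by
  refine (lintegral_exp_sum_gaussian_le hα _
    (b := fun n => (k : ℝ) ^ 2 / (8 * R ^ 4) * weight α n) (fun n _ => ?_)
    (fun n hn => ?_)).trans ?_
  · have := weight_pos α n
    positivity
  · have h1 := (Finset.mem_filter.1 hn).2
    have hw := weight_pos α n
    have h2 : (k / (2 * R ^ 2)) ^ 2 ≤ weight α n ^ 2 := by gcongr
    rw [← weight_pow_three]
    have h3 : (k : ℝ) ^ 2 / (8 * R ^ 4) = (k / (2 * R ^ 2)) ^ 2 / 2 := by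
      field_simp
      norm_num
    rw [h3]
    nlinarith
  · refine ENNReal.ofReal_le_ofReal (Real.exp_le_exp.2 ?_)
    simp only [mul_div_assoc, weight_div_prec]
    rw [← Finset.mul_sum]
    have h := sum_inv_weight_sq_le hα
      ((freq N).filter (fun n => k / (2 * R ^ 2) < weight α n))
    calc _ ≤ 2 * ((k : ℝ) ^ 2 / (8 * R ^ 4) * weightSum α) := by gcongr
      _ = _ := by field_simp; ring

theorem exists_lintegral_exp_lowNorm_le {α R : ℝ} (hα : 3 / 4 < α) (hR : 0 < R) :
    ∃ C : ℝ, 0 ≤ C ∧ ∀ (N : ℕ) (lam : ℝ), 0 ≤ lam →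
      ∫⁻ u, ENNReal.ofReal (Real.exp (lam * lowNorm α N u ^ 2)) ∂gaussianBall α R ≤
        ENNReal.ofReal (Real.exp (C * (1 + lam ^ 3))) := by
  set a : ℝ := 1 / (16 * R ^ 4) with ha
  set b : ℝ := weightSum α / (4 * R ^ 4) with hb
  have ha0 : 0 < a := by positivity
  have hb0 : 0 ≤ b := div_nonneg (weightSum_nonneg α) (by positivity)
  set C₀ : ℝ := (32 + 4 * (b + 1) ^ 3) / a ^ 2 + 4 with hC₀
  have hC₀0 : 0 ≤ C₀ := by positivity
  set K : ℝ := ∑' k : ℕ, Real.exp (-k) with hK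
  have hK0 : 0 ≤ K := tsum_nonneg fun k => (Real.exp_pos _).le
  refine ⟨C₀ + K, by positivity, fun N lam hl => ?_⟩
  set h : ℕ → L2 → ℝ := fun k u => ∑ n ∈ (freq N).filter (fun n => k / (2 * R ^ 2) < weight α n),
        (k : ℝ) ^ 2 / (8 * R ^ 4) * weight α n * ‖coef n u‖ ^ 2 with hh
  have hhc : ∀ k, Continuous (h k) := fun k =>
    continuous_finsetSum _ fun n _ => continuous_const.mul ((coef n).continuous.norm.pow 2)
  set e : ℕ → ℝ := fun k => lam * (k + 1 : ℝ) ^ 2 - a * (k : ℝ) ^ 3 with he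
  have hmeas : ∀ k, Measurable fun u => ENNReal.ofReal (Real.exp (e k)) *
      ENNReal.ofReal (Real.exp (h k u)) := fun k =>
    ((Real.continuous_exp.comp (hhc k)).measurable.ennreal_ofReal).const_mul _
  have hpt : ∀ u ∈ {u : L2 | ‖u‖ ≤ R}, ENNReal.ofReal (Real.exp (lam * lowNorm α N u ^ 2)) ≤
      ∑' k, ENNReal.ofReal (Real.exp (e k)) * ENNReal.ofReal (Real.exp (h k u)) := by
    intro u hu
    refine le_trans ?_ (ENNReal.le_tsum ⌊lowNorm α N u⌋₊)
    rw [← ENNReal.ofReal_mul (Real.exp_pos _).le, ← Real.exp_add]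
    refine ENNReal.ofReal_le_ofReal (Real.exp_le_exp.2 ?_)
    refine (exp_lowNorm_sq_le hR hl N hu _ rfl).trans_eq ?_
    simp only [he, ha, hh]
    ring
  calc ∫⁻ u, ENNReal.ofReal (Real.exp (lam * lowNorm α N u ^ 2)) ∂gaussianBall α R
      ≤ ∫⁻ u, ∑' k, ENNReal.ofReal (Real.exp (e k)) * ENNReal.ofReal (Real.exp (h k u))
          ∂gaussianBall α R := setLIntegral_mono' (measurableSet_ball_L2 R) hpt
    _ ≤ ∫⁻ u, ∑' k, ENNReal.ofReal (Real.exp (e k)) * ENNReal.ofReal (Real.exp (h k u))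
          ∂gaussian α := setLIntegral_le_lintegral _ _
    _ = ∑' k, ENNReal.ofReal (Real.exp (e k)) * ∫⁻ u, ENNReal.ofReal (Real.exp (h k u))
          ∂gaussian α := by
        rw [lintegral_tsum fun k => (hmeas k).aemeasurable]
        simp only [lintegral_const_mul' _ _ ENNReal.ofReal_ne_top]
    _ ≤ ∑' k : ℕ, ENNReal.ofReal (Real.exp (C₀ * (1 + lam ^ 3))) *
          ENNReal.ofReal (Real.exp (-k)) := by
        refine ENNReal.tsum_le_tsum fun k => ?_
        refine (mul_le_mul_right (lintegral_exp_high_le hα hR N k) _).trans ?_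
        rw [← ENNReal.ofReal_mul (Real.exp_pos _).le, ← ENNReal.ofReal_mul (Real.exp_pos _).le,
          ← Real.exp_add, ← Real.exp_add]
        exact ENNReal.ofReal_le_ofReal (Real.exp_le_exp.2
          (moment_exponent_le ha0 hb0 hl (Nat.cast_nonneg k)))
    _ = ENNReal.ofReal (Real.exp (C₀ * (1 + lam ^ 3))) * ENNReal.ofReal K := by
        rw [ENNReal.tsum_mul_left, hK, ENNReal.ofReal_tsum_of_nonneg
          (fun k => (Real.exp_pos _).le) Real.summable_exp_neg_nat]
    _ ≤ ENNReal.ofReal (Real.exp ((C₀ + K) * (1 + lam ^ 3))) := by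
        rw [← ENNReal.ofReal_mul (Real.exp_pos _).le,
          show (C₀ + K) * (1 + lam ^ 3) = C₀ * (1 + lam ^ 3) + K * (1 + lam ^ 3) by ring,
          Real.exp_add]
        refine ENNReal.ofReal_le_ofReal ?_
        refine mul_le_mul_of_nonneg_left ?_ (Real.exp_pos _).le
        have h1 : 0 ≤ K * lam ^ 3 := by positivity
        have h2 := Real.add_one_le_exp (K * (1 + lam ^ 3))
        linarith

end Moments

/-! ### The `L⁴` norm -/

section L4

open Filter Topology
open scoped ComplexConjugate

theorem integral_fourier (k : ℤ) :
    ∫ x : Torus, fourier k x ∂AddCircle.haarAddCircle = if k = 0 then 1 else 0 := by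
  have h := congrFun (fourierCoeff_fourier (T := 2 * Real.pi) k) 0
  rw [fourierCoeff] at h
  simp only [neg_zero, fourier_zero, one_smul] at h
  rw [h, Pi.single_apply]
  simp only [eq_comm]

theorem norm_pow_four_trigPoly (F : Finset ℤ) (c : ℤ → ℂ) (x : Torus) :
    ((‖∑ n ∈ F, c n * fourier n x‖ ^ 4 : ℝ) : ℂ) = ∑ p ∈ F ×ˢ F, ∑ q ∈ F ×ˢ F,
      c p.1 * c p.2 * (conj (c q.1) * conj (c q.2)) * fourier (p.1 + p.2 - (q.1 + q.2)) x := by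
  set W := ∑ n ∈ F, c n * fourier n x with hW
  have h1 : ((‖W‖ ^ 4 : ℝ) : ℂ) = W * W * (conj W * conj W) := by
    have : W * conj W = ((‖W‖ ^ 2 : ℝ) : ℂ) := by
      rw [Complex.mul_conj, Complex.normSq_eq_norm_sq]
    calc ((‖W‖ ^ 4 : ℝ) : ℂ) = ((‖W‖ ^ 2 : ℝ) : ℂ) * ((‖W‖ ^ 2 : ℝ) : ℂ) := by
          push_cast; ring
      _ = _ := by rw [← this]; ring
  have h2 : conj W = ∑ n ∈ F, conj (c n) * fourier (-n) x := by
    rw [hW, map_sum]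
    refine Finset.sum_congr rfl fun n _ => ?_
    rw [map_mul, fourier_neg]
  rw [h1, h2, hW, Finset.sum_mul_sum, Finset.sum_mul_sum, ← Finset.sum_product',
    ← Finset.sum_product', Finset.sum_mul_sum]
  refine Finset.sum_congr rfl fun p _ => Finset.sum_congr rfl fun q _ => ?_
  rw [show p.1 + p.2 - (q.1 + q.2) = p.1 + p.2 + (-q.1 + -q.2) by ring, fourier_add,
    fourier_add, fourier_add]
  ring

theorem integral_norm_pow_four_trigPoly_le {α : ℝ} (hα : 3 / 4 < α) (F : Finset ℤ) (c : ℤ → ℂ) :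
    ∫ x : Torus, ‖∑ n ∈ F, c n * fourier n x‖ ^ 4 ∂AddCircle.haarAddCircle ≤
      weightSum α * (∑ n ∈ F, weight α n * ‖c n‖ ^ 2) ^ 2 := by
  have hint : ∀ k : ℤ, Integrable (fun x : Torus => (fourier k x : ℂ)) AddCircle.haarAddCircle :=
    fun k => (fourier k).continuous.integrable_of_hasCompactSupport
      (HasCompactSupport.of_compactSpace _)
  have h1 : ((∫ x : Torus, ‖∑ n ∈ F, c n * fourier n x‖ ^ 4 ∂AddCircle.haarAddCircle : ℝ) : ℂ) =
      ∑ p ∈ F ×ˢ F, ∑ q ∈ F ×ˢ F, c p.1 * c p.2 * (conj (c q.1) * conj (c q.2)) *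
        (if p.1 + p.2 = q.1 + q.2 then 1 else 0) := by
    rw [← integral_complex_ofReal]
    simp only [norm_pow_four_trigPoly]
    rw [integral_finsetSum _ fun p _ => integrable_finsetSum _ fun q _ => (hint _).const_mul _]
    refine Finset.sum_congr rfl fun p _ => ?_
    rw [integral_finsetSum _ fun q _ => (hint _).const_mul _]
    refine Finset.sum_congr rfl fun q _ => ?_
    rw [integral_const_mul, integral_fourier]
    simp only [sub_eq_zero]
  have h2 := sum_quartic_le F (fun n => ‖c n‖) (weight α) (weight_pos α)
    (sum_inv_weight_sq_le hα F)
  refine le_trans ?_ h2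
  refine (le_abs_self _).trans ?_
  rw [← Real.norm_eq_abs, ← Complex.norm_real, h1]
  refine (norm_sum_le _ _).trans (Finset.sum_le_sum fun p _ => ?_)
  refine (norm_sum_le _ _).trans (Finset.sum_le_sum fun q _ => ?_)
  split_ifs <;> simp

theorem L4pow_trigPoly_le {α : ℝ} (hα : 3 / 4 < α) (F : Finset ℤ) (c : ℤ → ℂ) :
    L4pow (∑ n ∈ F, c n • (fourierLp 2 n : L2)) ≤
      ENNReal.ofReal (weightSum α * (∑ n ∈ F, weight α n * ‖c n‖ ^ 2) ^ 2) := by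
  have h1 : ⇑(∑ n ∈ F, c n • (fourierLp 2 n : L2)) =ᵐ[AddCircle.haarAddCircle]
      fun x => ∑ n ∈ F, c n * fourier n x := by
    have h2 : ∀ n : ℤ, ⇑(c n • (fourierLp 2 n : L2)) =ᵐ[AddCircle.haarAddCircle]
        fun x => c n * fourier n x := fun n => by
      filter_upwards [Lp.coeFn_smul (c n) (fourierLp 2 n : L2), coeFn_fourierLp 2 n] with x h h'
      rw [h, Pi.smul_apply, h', smul_eq_mul]
    filter_upwards [Lp.coeFn_finsetSum F fun n => c n • (fourierLp 2 n : L2),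
      (Finset.eventually_all F).2 fun n _ => h2 n] with x h h'
    rw [h, Finset.sum_apply]
    exact Finset.sum_congr rfl h'
  have hc : Continuous fun x : Torus => ‖∑ n ∈ F, c n * fourier n x‖ ^ 4 :=
    (continuous_finsetSum _ fun n _ => continuous_const.mul (fourier n).continuous).norm.pow 4
  refine le_trans (le_of_eq ?_)
    (ENNReal.ofReal_le_ofReal (integral_norm_pow_four_trigPoly_le hα F c))
  rw [ofReal_integral_eq_lintegral_ofReal (hc.integrable_of_hasCompactSupport
    (HasCompactSupport.of_compactSpace _)) (Eventually.of_forall fun x => by positivity)]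
  refine lintegral_congr_ae ?_
  filter_upwards [h1] with x hx
  rw [hx, ENNReal.ofReal_pow (norm_nonneg _), ofReal_norm]

/-- The `L⁴` norm is lower semicontinuous on `L²`. -/
theorem L4pow_le_of_tendsto {v : ℕ → L2} {u : L2} (h : Tendsto v atTop (𝓝 u)) {c : ℝ≥0∞}
    (hc : ∀ n, L4pow (v n) ≤ c) : L4pow u ≤ c := by
  obtain ⟨φ, -, hφ⟩ := (tendstoInMeasure_of_tendsto_Lp h).exists_seq_tendsto_ae
  have hpow : Continuous fun z : ℂ => ‖z‖ₑ ^ 4 := (ENNReal.continuous_pow 4).comp continuous_enorm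
  calc L4pow u ≤ ∫⁻ x, liminf (fun n => ‖v (φ n) x‖ₑ ^ 4) atTop ∂AddCircle.haarAddCircle := by
        refine lintegral_mono_ae ?_
        filter_upwards [hφ] with x hx
        exact (((hpow.tendsto _).comp hx).liminf_eq).ge
    _ ≤ liminf (fun n => L4pow (v (φ n))) atTop :=
        lintegral_liminf_le' fun n =>
          hpow.measurable.comp_aemeasurable (Lp.aestronglyMeasurable (v (φ n))).aemeasurable
    _ ≤ c := by
        refine liminf_le_of_frequently_le' (Frequently.of_forall fun n => hc _)

theorem measurable_L4pow : Measurable L4pow := by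
  refine measurable_of_Iic fun c => IsClosed.measurableSet ?_
  refine isSeqClosed_iff_isClosed.1 fun v u hv h => ?_
  exact L4pow_le_of_tendsto h hv

theorem L4pow_le_of_lowNorm {α : ℝ} (hα : 3 / 4 < α) {u : L2} {c : ℝ}
    (h : ∀ N, weightSum α * lowNorm α N u ^ 2 ≤ c) : L4pow u ≤ ENNReal.ofReal c := by
  have h1 := hasSum_fourier_series_L2 u
  rw [HasSum, SummationFilter.unconditional_filter] at h1
  have h2 : Tendsto (fun N : ℕ => ∑ n ∈ freq N, coef n u • (fourierLp 2 n : L2)) atTop (𝓝 u) := by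
    simp only [coef_apply]
    exact (h1.comp (Finset.tendsto_Icc_neg (R := ℤ))).comp tendsto_natCast_atTop_atTop
  refine L4pow_le_of_tendsto h2 fun N =>
    (L4pow_trigPoly_le hα _ _).trans (ENNReal.ofReal_le_ofReal ?_)
  rw [← lowNorm_eq]
  exact h N

/-- `exp (k ‖u‖_{L⁴}⁴)`. -/
def expL4 (k : ℝ) (u : L2) : ℝ≥0∞ := EReal.exp ((k : EReal) * (L4pow u : EReal))

theorem measurable_expL4 (k : ℝ) : Measurable (expL4 k) := by
  unfold expL4
  have h := measurable_L4pow
  exact EReal.measurable_exp.comp (by fun_prop)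

theorem expL4_of_ne_top (k : ℝ) {u : L2} (hu : L4pow u ≠ ∞) :
    expL4 k u = ENNReal.ofReal (Real.exp (k * (L4pow u).toReal)) := by
  rw [expL4, ← EReal.exp_coe, EReal.coe_mul]
  lift L4pow u to NNReal using hu with r
  rfl

theorem expL4_le_iSup {α : ℝ} (hα : 3 / 4 < α) {k : ℝ} (hk : 0 < k) (u : L2) :
    expL4 k u ≤ ⨆ N, ENNReal.ofReal (Real.exp (k * weightSum α * lowNorm α N u ^ 2)) := by
  set M := ⨆ N, ENNReal.ofReal (Real.exp (k * weightSum α * lowNorm α N u ^ 2)) with hM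
  rcases eq_or_ne M ∞ with htop | htop
  · simp [htop]
  have hle : ∀ N, Real.exp (k * weightSum α * lowNorm α N u ^ 2) ≤ M.toReal := fun N => by
    rw [← ENNReal.ofReal_le_iff_le_toReal htop]
    exact le_iSup (fun N => ENNReal.ofReal (Real.exp (k * weightSum α * lowNorm α N u ^ 2))) N
  have hMpos : 0 < M.toReal := (Real.exp_pos _).trans_le (hle 0)
  have h1 : L4pow u ≤ ENNReal.ofReal (Real.log M.toReal / k) := by
    refine L4pow_le_of_lowNorm hα fun N => ?_
    rw [le_div_iff₀ hk, Real.le_log_iff_exp_le hMpos]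
    refine (Real.exp_le_exp.2 (le_of_eq ?_)).trans (hle N)
    ring
  have hlog : 0 ≤ Real.log M.toReal / k := by
    refine div_nonneg (Real.log_nonneg ?_) hk.le
    refine (Real.one_le_exp ?_).trans (hle 0)
    have := weightSum_nonneg α
    positivity
  rw [expL4_of_ne_top k (h1.trans_lt ENNReal.ofReal_lt_top).ne]
  refine ENNReal.ofReal_le_of_le_toReal ?_
  rw [← Real.le_log_iff_exp_le hMpos]
  have := ENNReal.toReal_le_of_le_ofReal hlog h1
  rw [le_div_iff₀ hk] at this
  linarith

theorem lintegral_expL4_lt_top {α R k : ℝ} (hα : 3 / 4 < α) (hR : 0 < R) (hk : 0 < k) :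
    ∫⁻ u, expL4 k u ∂gaussianBall α R < ∞ := by
  obtain ⟨C, hC, h⟩ := exists_lintegral_exp_lowNorm_le hα hR
  have hS := weightSum_nonneg α
  have hks : 0 ≤ k * weightSum α := by positivity
  refine (lintegral_mono fun u => expL4_le_iSup hα hk u).trans_lt ?_
  rw [lintegral_iSup]
  · refine (iSup_le fun N => h N (k * weightSum α) hks).trans_lt ENNReal.ofReal_lt_top
  · intro N
    exact (Real.continuous_exp.comp
      (continuous_const.mul ((continuous_lowNorm α N).pow 2))).measurable.ennreal_ofReal
  · intro M N hMN u
    refine ENNReal.ofReal_le_ofReal (Real.exp_le_exp.2 ?_)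
    have := lowNorm_mono α u hMN
    have h0 := lowNorm_nonneg α M u
    simp only at this
    gcongr

theorem ae_L4pow_ne_top {α R : ℝ} (hα : 3 / 4 < α) (hR : 0 < R) :
    ∀ᵐ u ∂gaussianBall α R, L4pow u ≠ ∞ := by
  filter_upwards [ae_lt_top (measurable_expL4 1)
    (lintegral_expL4_lt_top hα hR one_pos).ne] with u hu htop
  simp [expL4, htop] at hu

end L4

/-! ### Moments of the transported density -/

section DensityMoments

theorem isFiniteMeasure_gaussianBall {α : ℝ} (hα : 3 / 4 < α) (R : ℝ) :
    IsFiniteMeasure (gaussianBall α R) := by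
  have := isProbabilityMeasure_gaussian hα
  unfold gaussianBall
  infer_instance

theorem ofReal_exp_rpow (a r : ℝ) :
    ENNReal.ofReal (Real.exp a) ^ r = ENNReal.ofReal (Real.exp (r * a)) := by
  rw [ENNReal.ofReal_rpow_of_pos (Real.exp_pos a), ← Real.exp_mul, mul_comm]

theorem ofReal_exp_mul (a b : ℝ) : ENNReal.ofReal (Real.exp a) * ENNReal.ofReal (Real.exp b) =
    ENNReal.ofReal (Real.exp (a + b)) := by
  rw [← ENNReal.ofReal_mul (Real.exp_pos a).le, Real.exp_add]

theorem ofReal_exp_mono {a b : ℝ} (h : a ≤ b) :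
    ENNReal.ofReal (Real.exp a) ≤ ENNReal.ofReal (Real.exp b) :=
  ENNReal.ofReal_le_ofReal (Real.exp_le_exp.2 h)

theorem exists_le_ofReal_exp {x : ℝ≥0∞} (hx : x ≠ ∞) :
    ∃ a : ℝ, 0 ≤ a ∧ x ≤ ENNReal.ofReal (Real.exp a) := by
  refine ⟨x.toReal, ENNReal.toReal_nonneg, ?_⟩
  refine (ENNReal.ofReal_toReal hx).ge.trans (ENNReal.ofReal_le_ofReal ?_)
  linarith [Real.add_one_le_exp x.toReal]

theorem modeEnergy_nonneg (α : ℝ) (N : ℕ) (x : Modes N) : 0 ≤ modeEnergy α N x :=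
  Finset.sum_nonneg fun n _ => mul_nonneg (prec_pos α n).le (by positivity)

theorem flowDensity_le (α σ : ℝ) (N : ℕ) (t : ℝ) {R : ℝ} {u : L2} (hu : ‖u‖ ≤ R) :
    flowDensity α σ N t u ≤ Real.exp ((∑ n ∈ freq N, prec α n) * R ^ 2) := by
  refine Real.exp_le_exp.2 ?_
  have h1 := modeEnergy_nonneg α N (modeFlow α σ N t (lowProj N u))
  have h2 : modeEnergy α N (lowProj N u) = ∑ n ∈ freq N, prec α n * ‖coef n u‖ ^ 2 :=
    Finset.sum_coe_sort (freq N) fun n => prec α n * ‖coef n u‖ ^ 2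
  have h3 : ∑ n ∈ freq N, prec α n * ‖coef n u‖ ^ 2 ≤ ∑ n ∈ freq N, prec α n * R ^ 2 := by
    refine Finset.sum_le_sum fun n _ => mul_le_mul_of_nonneg_left ?_ (prec_pos α n).le
    have h4 := sum_norm_coef_sq_le {n} u
    rw [Finset.sum_singleton] at h4
    exact h4.trans (pow_le_pow_left₀ (norm_nonneg _) hu 2)
  rw [← Finset.sum_mul] at h3
  linarith

/-- The `p`-th moment of the density is finite, with a bound that depends on `N`. -/
theorem lintegral_flowDensity_rpow_le (α σ R : ℝ) (N : ℕ) (s : ℝ) {p : ℝ}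
    (hp : 0 ≤ p) : ∫⁻ u, ENNReal.ofReal (flowDensity α σ N s u) ^ p ∂gaussianBall α R ≤
      ENNReal.ofReal (Real.exp ((∑ n ∈ freq N, prec α n) * R ^ 2)) ^ p *
        gaussianBall α R Set.univ := by
  rw [← lintegral_const]
  refine setLIntegral_mono' (measurableSet_ball_L2 R) fun u hu => ?_
  exact ENNReal.rpow_le_rpow (ENNReal.ofReal_le_ofReal (flowDensity_le α σ N s hu)) hp

theorem flowDensity_rpow_le {α σ : ℝ} (hα : 3 / 4 < α) (hσ : |σ| ≤ 1) (N : ℕ) (s : ℝ) {p T : ℝ}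
    (hp : 0 ≤ p) (hs : |s| ≤ T) (u : L2) :
    ENNReal.ofReal (flowDensity α σ N s u) ^ p ≤
      ∫⁻ r in Set.Ioc (0 : ℝ) 1, ENNReal.ofReal (Real.exp
        (p * T * weightSum α * lowNorm α N (flow α σ N (r * s) u) ^ 2)) := by
  have hS := weightSum_nonneg α
  have hT := (abs_nonneg s).trans hs
  set f : ℝ → ℝ := fun r => p * T * weightSum α *
    modeNorm α N (modeFlow α σ N (r * s) (lowProj N u)) ^ 2 with hf
  have hfc : Continuous f := continuous_const.mul (((continuous_modeNorm α N).comp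
    ((continuous_modeFlow_time α σ N (lowProj N u)).comp (continuous_mul_const s))).pow 2)
  have hint : ∀ g : ℝ → ℝ, Continuous g → Integrable g (volume.restrict (Set.Ioc (0 : ℝ) 1)) :=
    fun g hg => (hg.integrableOn_Icc).mono_set Set.Ioc_subset_Icc_self
  have hprob : IsProbabilityMeasure (volume.restrict (Set.Ioc (0 : ℝ) 1)) := ⟨by simp⟩
  have hexp : Continuous fun r => Real.exp (f r) := Real.continuous_exp.comp hfc
  simp only [lowNorm, lowProj_flow]
  change _ ≤ ∫⁻ r in Set.Ioc (0 : ℝ) 1, ENNReal.ofReal (Real.exp (f r))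
  rw [flowDensity, ofReal_exp_rpow, ← ofReal_integral_eq_lintegral_ofReal (hint _ hexp)
    (Filter.Eventually.of_forall fun r => (Real.exp_pos _).le)]
  refine ENNReal.ofReal_le_ofReal ?_
  refine le_trans (Real.exp_le_exp.2 ?_) (convexOn_exp.map_integral_le
    Real.continuous_exp.continuousOn isClosed_univ (by simp) (hint _ hfc) (hint _ hexp))
  refine (mul_le_mul_of_nonneg_left (modeEnergy_sub_le hα hσ N (lowProj N u) s) hp).trans ?_
  rw [intervalIntegral.integral_of_le zero_le_one, ← integral_const_mul]
  refine integral_mono_of_nonneg (Filter.Eventually.of_forall fun r => by positivity) (hint _ hfc)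
    (Filter.Eventually.of_forall fun r => ?_)
  simp only [hf, ← mul_assoc]
  gcongr

theorem measurable_uncurry_exp_lowNorm_flow (α σ : ℝ) (N : ℕ) (s c : ℝ) :
    Measurable (Function.uncurry fun (u : L2) (r : ℝ) => ENNReal.ofReal (Real.exp
      (c * lowNorm α N (flow α σ N (r * s) u) ^ 2))) := by
  have h : Measurable (Function.uncurry fun (r : ℝ) (u : L2) =>
      modeNorm α N (modeFlow α σ N (r * s) (lowProj N u))) :=
    measurable_uncurry_of_continuous_of_measurable
      (fun u => (continuous_modeNorm α N).comp
        ((continuous_modeFlow_time α σ N (lowProj N u)).comp (continuous_mul_const s)))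
      (fun r => ((continuous_modeNorm α N).comp
        ((continuous_modeFlow α σ N _).comp (lowProj N).continuous)).measurable)
  have h2 := h.comp measurable_swap
  simp only [lowNorm, lowProj_flow]
  exact (Real.measurable_exp.comp ((h2.pow_const 2).const_mul c)).ennreal_ofReal

/-- A self-improving estimate for the moments of the transported density. -/
theorem lintegral_flowDensity_rpow_le_mul {α σ R : ℝ} (hα : 3 / 4 < α) (hσ : |σ| ≤ 1) (N : ℕ)
    {s T p q : ℝ} (hpq : p.HolderConjugate q) (hs : |s| ≤ T) {M : ℝ≥0∞}
    (hM : ∀ s, |s| ≤ T →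
      ∫⁻ u, ENNReal.ofReal (flowDensity α σ N s u) ^ p ∂gaussianBall α R ≤ M) :
    ∫⁻ u, ENNReal.ofReal (flowDensity α σ N s u) ^ p ∂gaussianBall α R ≤
      (∫⁻ u, ENNReal.ofReal (Real.exp (q * (p * T * weightSum α) * lowNorm α N u ^ 2))
        ∂gaussianBall α R) ^ (1 / q) * M ^ (1 / p) := by
  have := isFiniteMeasure_gaussianBall hα R
  set c := p * T * weightSum α with hc
  have hH : Measurable fun u => ENNReal.ofReal (Real.exp (c * lowNorm α N u ^ 2)) :=
    (Real.continuous_exp.comp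
      (continuous_const.mul ((continuous_lowNorm α N).pow 2))).measurable.ennreal_ofReal
  calc ∫⁻ u, ENNReal.ofReal (flowDensity α σ N s u) ^ p ∂gaussianBall α R
      ≤ ∫⁻ u, (∫⁻ r in Set.Ioc (0 : ℝ) 1, ENNReal.ofReal (Real.exp
          (c * lowNorm α N (flow α σ N (r * s) u) ^ 2))) ∂gaussianBall α R :=
        lintegral_mono fun u => flowDensity_rpow_le hα hσ N s hpq.nonneg hs u
    _ = ∫⁻ r in Set.Ioc (0 : ℝ) 1, ∫⁻ u, ENNReal.ofReal (Real.exp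
          (c * lowNorm α N (flow α σ N (r * s) u) ^ 2)) ∂gaussianBall α R :=
        lintegral_lintegral_swap (measurable_uncurry_exp_lowNorm_flow α σ N s c).aemeasurable
    _ ≤ ∫⁻ r in Set.Ioc (0 : ℝ) 1,
        (∫⁻ u, ENNReal.ofReal (Real.exp (q * c * lowNorm α N u ^ 2))
          ∂gaussianBall α R) ^ (1 / q) * M ^ (1 / p) := by
        refine setLIntegral_mono' measurableSet_Ioc fun r hr => ?_
        rw [lintegral_gaussianBall_comp_flow hα σ R N (r * s) hH]
        refine (ENNReal.lintegral_mul_le_Lp_mul_Lq _ hpq.symm hH.aemeasurable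
          (measurable_flowDensity α σ N (-(r * s))).aemeasurable).trans ?_
        simp only [ofReal_exp_rpow, ← mul_assoc]
        gcongr
        · exact (one_div_pos.2 hpq.pos).le
        · refine hM _ ?_
          rw [abs_neg, abs_mul, abs_of_pos hr.1]
          nlinarith [abs_nonneg s, hr.2]
    _ = _ := by simp

theorem lintegral_flowDensity_rpow_le_lowNorm {α σ R : ℝ} (hα : 3 / 4 < α) (hσ : |σ| ≤ 1) (N : ℕ)
    (t : ℝ) {p q : ℝ} (hpq : p.HolderConjugate q) :
    ∫⁻ u, ENNReal.ofReal (flowDensity α σ N t u) ^ p ∂gaussianBall α R ≤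
      ∫⁻ u, ENNReal.ofReal (Real.exp (q * (p * |t| * weightSum α) * lowNorm α N u ^ 2))
        ∂gaussianBall α R := by
  have := isFiniteMeasure_gaussianBall hα R
  set Θ := ∫⁻ u, ENNReal.ofReal (Real.exp (q * (p * |t| * weightSum α) * lowNorm α N u ^ 2))
        ∂gaussianBall α R with hΘ
  set M : ℝ≥0∞ := ⨆ s : {s : ℝ // |s| ≤ |t|},
    ∫⁻ u, ENNReal.ofReal (flowDensity α σ N s u) ^ p ∂gaussianBall α R with hM
  have hle : ∀ s, |s| ≤ |t| →
      ∫⁻ u, ENNReal.ofReal (flowDensity α σ N s u) ^ p ∂gaussianBall α R ≤ M := fun s hs =>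
    le_iSup (fun s : {s : ℝ // |s| ≤ |t|} =>
      ∫⁻ u, ENNReal.ofReal (flowDensity α σ N s u) ^ p ∂gaussianBall α R) ⟨s, hs⟩
  have hfin : M ≠ ∞ := by
    refine ((iSup_le fun s : {s : ℝ // |s| ≤ |t|} => lintegral_flowDensity_rpow_le α σ R N s hpq.nonneg).trans_lt
      (ENNReal.mul_lt_top ?_ (measure_lt_top _ _))).ne
    rw [ofReal_exp_rpow]
    exact ENNReal.ofReal_lt_top
  have hself : M ≤ Θ ^ (1 / q) * M ^ (1 / p) :=
    iSup_le fun s => lintegral_flowDensity_rpow_le_mul hα hσ N hpq s.2 hle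
  refine (hle t le_rfl).trans ?_
  rcases eq_or_ne M 0 with h0 | h0
  · simp [h0]
  have hq : 0 < 1 / q := one_div_pos.2 hpq.symm.pos
  rw [← ENNReal.rpow_le_rpow_iff hq]
  have hsum : 1 / q + 1 / p = 1 := by
    rw [one_div, one_div, add_comm]
    exact hpq.inv_add_inv_eq_one
  have hsplit : M = M ^ (1 / q) * M ^ (1 / p) := by
    rw [← ENNReal.rpow_add _ _ h0 hfin, hsum, ENNReal.rpow_one]
  have hp0 : M ^ (1 / p) ≠ 0 := by simp [h0, hfin]
  have hpt : M ^ (1 / p) ≠ ∞ := ENNReal.rpow_ne_top_of_nonneg (one_div_pos.2 hpq.pos).le hfin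
  exact (ENNReal.mul_le_mul_iff_left hp0 hpt).1 (hsplit.ge.trans hself)

theorem exists_lintegral_flowDensity_rpow_le {α σ R p q : ℝ} (hα : 3 / 4 < α) (hσ : |σ| ≤ 1)
    (hR : 0 < R) (hpq : p.HolderConjugate q) : ∃ C : ℝ, 0 ≤ C ∧ ∀ (N : ℕ) (t : ℝ),
      ∫⁻ u, ENNReal.ofReal (flowDensity α σ N t u) ^ p ∂gaussianBall α R ≤
        ENNReal.ofReal (Real.exp (C * (1 + |t| ^ 3))) := by
  obtain ⟨C, hC, h⟩ := exists_lintegral_exp_lowNorm_le hα hR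
  have hS := weightSum_nonneg α
  have hp := hpq.pos
  have hq := hpq.symm.pos
  refine ⟨C * (1 + (q * p * weightSum α) ^ 3), by positivity, fun N t => ?_⟩
  refine (lintegral_flowDensity_rpow_le_lowNorm hα hσ N t hpq).trans
    ((h N _ (by positivity)).trans (ofReal_exp_mono ?_))
  have h1 : 0 ≤ |t| ^ 3 := by positivity
  have h2 : 0 ≤ (q * p * weightSum α) ^ 3 := by positivity
  rw [mul_assoc C]
  refine mul_le_mul_of_nonneg_left ?_ hC
  have h3 : (q * (p * |t| * weightSum α)) ^ 3 = (q * p * weightSum α) ^ 3 * |t| ^ 3 := by ring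
  rw [h3]
  nlinarith

theorem exists_gaussianBall_image_flow_le {α σ R p q : ℝ} (hα : 3 / 4 < α) (hσ : |σ| ≤ 1)
    (hR : 0 < R) (hpq : p.HolderConjugate q) : ∃ C : ℝ, 0 ≤ C ∧ ∀ (N : ℕ) (t : ℝ) (A : Set L2),
      MeasurableSet A → gaussianBall α R (flow α σ N t '' A) ≤
        ENNReal.ofReal (Real.exp (C * (1 + |t| ^ 3))) * gaussianBall α R A ^ (1 / q) := by
  obtain ⟨C, hC, h⟩ := exists_lintegral_flowDensity_rpow_le hα hσ hR hpq
  have hp := hpq.pos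
  refine ⟨1 / p * C, by positivity, fun N t A hA => ?_⟩
  rw [gaussianBall_image_flow hα σ R N t hA]
  have h1 := ENNReal.lintegral_mul_le_Lp_mul_Lq ((gaussianBall α R).restrict A) hpq
    (measurable_flowDensity α σ N t).aemeasurable (g := fun _ => 1) aemeasurable_const
  simp only [Pi.mul_apply, mul_one, ENNReal.one_rpow, lintegral_one, Measure.restrict_apply_univ]
    at h1
  refine h1.trans (mul_le_mul_left ?_ _)
  rw [mul_assoc, ← ofReal_exp_rpow]
  exact ENNReal.rpow_le_rpow ((setLIntegral_le_lintegral _ _).trans (h N t))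
    (one_div_pos.2 hp).le

end DensityMoments

/-! ### The Gibbs measure -/

section Gibbs

theorem gibbs_apply (α σ R : ℝ) {A : Set L2} (hA : MeasurableSet A) :
    gibbs α σ R A = ∫⁻ u in A, expL4 (-(σ / 2)) u ∂gaussianBall α R :=
  withDensity_apply _ hA

theorem lintegral_expL4_rpow_lt_top {α R k r : ℝ} (hα : 3 / 4 < α) (hR : 0 < R) :
    ∫⁻ u, expL4 k u ^ r ∂gaussianBall α R < ∞ := by
  refine lt_of_le_of_lt (lintegral_mono_ae ?_)
    (lintegral_expL4_lt_top hα hR (k := |r * k| + 1) (by positivity))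
  filter_upwards [ae_L4pow_ne_top hα hR] with u hu
  rw [expL4_of_ne_top _ hu, expL4_of_ne_top _ hu, ofReal_exp_rpow, ← mul_assoc]
  refine ofReal_exp_mono (mul_le_mul_of_nonneg_right ?_ ENNReal.toReal_nonneg)
  linarith [le_abs_self (r * k)]

theorem exists_lintegral_expL4_rpow_le {α R k p : ℝ} (hα : 3 / 4 < α) (hR : 0 < R) (hp : 0 < p) :
    ∃ C : ℝ, 0 ≤ C ∧ ∀ A : Set L2, (∫⁻ u in A, expL4 k u ^ p ∂gaussianBall α R) ^ (1 / p) ≤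
      ENNReal.ofReal (Real.exp C) := by
  obtain ⟨a, ha, h⟩ := exists_le_ofReal_exp
    (lintegral_expL4_rpow_lt_top (k := k) (r := p) hα hR).ne
  refine ⟨1 / p * a, by positivity, fun A => ?_⟩
  rw [← ofReal_exp_rpow]
  exact ENNReal.rpow_le_rpow ((setLIntegral_le_lintegral _ _).trans h) (by positivity)

theorem exists_gibbs_le {α R p q : ℝ} (σ : ℝ) (hα : 3 / 4 < α) (hR : 0 < R)
    (hpq : p.HolderConjugate q) : ∃ C : ℝ, 0 ≤ C ∧ ∀ A : Set L2, MeasurableSet A →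
      gibbs α σ R A ≤ ENNReal.ofReal (Real.exp C) * gaussianBall α R A ^ (1 / q) := by
  obtain ⟨C, hC, h⟩ := exists_lintegral_expL4_rpow_le (k := -(σ / 2)) hα hR hpq.pos
  refine ⟨C, hC, fun A hA => ?_⟩
  have h1 := ENNReal.lintegral_mul_le_Lp_mul_Lq ((gaussianBall α R).restrict A) hpq
    (measurable_expL4 (-(σ / 2))).aemeasurable (g := fun _ => 1) aemeasurable_const
  simp only [Pi.mul_apply, mul_one, ENNReal.one_rpow, lintegral_one, Measure.restrict_apply_univ]
    at h1
  rw [gibbs_apply α σ R hA]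
  exact h1.trans (mul_le_mul_left (h A) _)

theorem exists_gaussianBall_le {α R p q : ℝ} (σ : ℝ) (hα : 3 / 4 < α) (hR : 0 < R)
    (hpq : p.HolderConjugate q) : ∃ C : ℝ, 0 ≤ C ∧ ∀ A : Set L2, MeasurableSet A →
      gaussianBall α R A ≤ ENNReal.ofReal (Real.exp C) * gibbs α σ R A ^ (1 / q) := by
  obtain ⟨C, hC, h⟩ := exists_lintegral_expL4_rpow_le (k := σ / 2 / q) hα hR hpq.pos
  refine ⟨C, hC, fun A hA => ?_⟩
  have hq := hpq.symm.pos
  have h1 := ENNReal.lintegral_mul_le_Lp_mul_Lq ((gaussianBall α R).restrict A) hpq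
    (measurable_expL4 (σ / 2 / q)).aemeasurable (measurable_expL4 (-(σ / 2 / q))).aemeasurable
  have hae := ae_restrict_of_ae (s := A) (ae_L4pow_ne_top hα hR)
  have h2 : ∫⁻ u in A, (expL4 (σ / 2 / q) * expL4 (-(σ / 2 / q))) u ∂gaussianBall α R =
      gaussianBall α R A := by
    rw [← Measure.restrict_apply_univ A, ← lintegral_one]
    refine lintegral_congr_ae ?_
    filter_upwards [hae] with u hu
    rw [Pi.mul_apply, expL4_of_ne_top _ hu, expL4_of_ne_top _ hu, ofReal_exp_mul]
    simp
  have h3 : ∫⁻ u in A, expL4 (-(σ / 2 / q)) u ^ q ∂gaussianBall α R = gibbs α σ R A := by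
    rw [gibbs_apply α σ R hA]
    refine lintegral_congr_ae ?_
    filter_upwards [hae] with u hu
    rw [expL4_of_ne_top _ hu, expL4_of_ne_top _ hu, ofReal_exp_rpow]
    congr 2
    field_simp
  rw [h2, h3] at h1
  exact h1.trans (mul_le_mul_left (h A) _)

theorem gibbs_ne_top {α R : ℝ} (σ : ℝ) (hα : 3 / 4 < α) (hR : 0 < R) (A : Set L2) :
    gibbs α σ R A ≠ ∞ := by
  refine ((measure_mono (Set.subset_univ A)).trans_lt ?_).ne
  rw [gibbs_apply α σ R MeasurableSet.univ]
  have := lintegral_expL4_rpow_lt_top (k := -(σ / 2)) (r := 1) hα hR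
  simpa using this

theorem exists_gibbs_image_flow_le_of_lt_one {α σ R ε : ℝ} (hα : 3 / 4 < α) (hσ : |σ| ≤ 1)
    (hR : 0 < R) (h0 : 0 < ε) (h1 : ε < 1) : ∃ C : ℝ, 0 ≤ C ∧ ∀ (N : ℕ) (t : ℝ) (A : Set L2),
      MeasurableSet A → gibbs α σ R (flow α σ N t '' A) ≤
        gibbs α σ R A ^ (1 - ε) * ENNReal.ofReal (Real.exp (C * (1 + |t| ^ 3))) := by
  set θ : ℝ := (1 - ε) ^ (1 / 3 : ℝ) with hθ
  have hθ0 : 0 < θ := Real.rpow_pos_of_pos (by linarith) _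
  have hθ1 : θ < 1 := Real.rpow_lt_one (by linarith) (by linarith) (by norm_num)
  have hθ3 : θ * (θ * θ) = 1 - ε := by
    have : θ ^ 3 = 1 - ε := by
      rw [hθ, ← Real.rpow_natCast, ← Real.rpow_mul (by linarith)]
      norm_num
    rw [← this]
    ring
  have hpq : ((1 - θ)⁻¹).HolderConjugate θ⁻¹ :=
    Real.holderConjugate_iff.2 ⟨(one_lt_inv₀ (by linarith)).2 (by linarith), by simp⟩
  obtain ⟨C₁, hC₁, hb₁⟩ := exists_gibbs_le σ hα hR hpq
  obtain ⟨C₂, hC₂, hb₂⟩ := exists_gaussianBall_image_flow_le hα hσ hR hpq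
  obtain ⟨C₃, hC₃, hb₃⟩ := exists_gaussianBall_le σ hα hR hpq
  simp only [one_div, inv_inv] at hb₁ hb₂ hb₃
  refine ⟨C₁ + θ * C₂ + θ * θ * C₃, by positivity, fun N t A hA => ?_⟩
  have hm : MeasurableSet (flow α σ N t '' A) := by
    rw [image_flow]
    exact measurable_flow α σ N (-t) hA
  calc gibbs α σ R (flow α σ N t '' A)
      ≤ ENNReal.ofReal (Real.exp C₁) * (ENNReal.ofReal (Real.exp (C₂ * (1 + |t| ^ 3))) *
          (ENNReal.ofReal (Real.exp C₃) * gibbs α σ R A ^ θ) ^ θ) ^ θ := by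
        refine (hb₁ _ hm).trans ?_
        gcongr
        refine (hb₂ N t A hA).trans ?_
        gcongr
        exact hb₃ A hA
    _ = gibbs α σ R A ^ (1 - ε) * ENNReal.ofReal (Real.exp
          (C₁ + θ * (C₂ * (1 + |t| ^ 3)) + θ * θ * C₃)) := by
        rw [ENNReal.mul_rpow_of_nonneg _ _ hθ0.le, ENNReal.mul_rpow_of_nonneg _ _ hθ0.le,
          ENNReal.mul_rpow_of_nonneg _ _ hθ0.le, ofReal_exp_rpow, ofReal_exp_rpow, ofReal_exp_rpow,
          ← ENNReal.rpow_mul, ← ENNReal.rpow_mul, hθ3, ← mul_assoc, ← mul_assoc,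
          ofReal_exp_mul, ofReal_exp_mul, mul_comm, ← mul_assoc θ θ C₃]
    _ ≤ _ := by
        refine mul_le_mul_right (ofReal_exp_mono ?_) _
        have ht : 0 ≤ |t| ^ 3 := by positivity
        have h2 : 0 ≤ C₁ * |t| ^ 3 := by positivity
        have h3 : 0 ≤ θ * θ * C₃ * |t| ^ 3 := by positivity
        linarith

theorem exists_gibbs_image_flow_le {α σ R ε : ℝ} (hα : 3 / 4 < α) (hσ : |σ| ≤ 1)
    (hR : 0 < R) (h0 : 0 < ε) : ∃ C : ℝ, 0 ≤ C ∧ ∀ (N : ℕ) (t : ℝ) (A : Set L2),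
      MeasurableSet A → gibbs α σ R (flow α σ N t '' A) ≤
        gibbs α σ R A ^ (1 - ε) * ENNReal.ofReal (Real.exp (C * (1 + |t| ^ 3))) := by
  rcases lt_or_ge ε 1 with h1 | h1
  · exact exists_gibbs_image_flow_le_of_lt_one hα hσ hR h0 h1
  obtain ⟨C, hC, h⟩ := exists_gibbs_image_flow_le_of_lt_one hα hσ hR
    (one_half_pos (α := ℝ)) one_half_lt_one
  obtain ⟨a, ha, hZ⟩ := exists_le_ofReal_exp (gibbs_ne_top σ hα hR Set.univ)
  refine ⟨C + (ε - 1 / 2) * a, by nlinarith, fun N t A hA => (h N t A hA).trans ?_⟩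
  rcases eq_or_ne (gibbs α σ R A) 0 with hz | hz
  · rw [hz, ENNReal.zero_rpow_of_pos (by norm_num), zero_mul]
    exact zero_le
  · have he : (1 - 1 / 2 : ℝ) = (1 - ε) + (ε - 1 / 2) := by ring
    rw [he, ENNReal.rpow_add _ _ hz (gibbs_ne_top σ hα hR A), mul_assoc]
    refine mul_le_mul_right ?_ _
    have h2 : gibbs α σ R A ^ (ε - 1 / 2) ≤ ENNReal.ofReal (Real.exp ((ε - 1 / 2) * a)) := by
      rw [← ofReal_exp_rpow]
      exact ENNReal.rpow_le_rpow ((measure_mono (Set.subset_univ A)).trans hZ) (by linarith)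
    refine (mul_le_mul_left h2 _).trans ?_
    rw [ofReal_exp_mul]
    refine ofReal_exp_mono ?_
    have h3 : 0 ≤ (ε - 1 / 2) * a := mul_nonneg (by linarith) ha
    have h4 : 0 ≤ (ε - 1 / 2) * a * |t| ^ 3 := mul_nonneg h3 (by positivity)
    linarith

end Gibbs

/-! ### The exponents -/

section Exponents

theorem three_quarters_lt_alphaBar : 3 / 4 < alphaBar := by
  have : (9 : ℝ) < Real.sqrt 97 := Real.lt_sqrt_of_sq_lt (by norm_num)
  unfold alphaBar
  linarith

theorem one_lt_zeta {α : ℝ} (hα : alphaBar < α) (hα1 : α ≤ 1) : 1 < zeta α := by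
  have h34 := three_quarters_lt_alphaBar.trans hα
  have hden : 0 < 4 - 4 * α ^ 2 + 3 * α := by nlinarith
  have h2 : 1 < 2 * α * (α + 1) / (4 - 4 * α ^ 2 + 3 * α) := by
    rw [one_lt_div hden]
    have hs : Real.sqrt 97 < 12 * α - 1 := by
      unfold alphaBar at hα
      linarith
    have := (Real.sqrt_lt' (by linarith)).1 hs
    nlinarith
  unfold zeta
  split_ifs with h
  · exact h2
  · have h1 : 0 < 1 - α := sub_pos.2 (lt_of_le_of_ne hα1 h)
    refine lt_min ?_ h2
    have : 2 / 3 < (2 * α - 1) / (3 * (1 - α)) := by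
      rw [lt_div_iff₀ (by positivity)]
      linarith
    linarith

theorem zeta_le {α : ℝ} (hα : alphaBar < α) (hα1 : α ≤ 1) : zeta α ≤ 3 / 2 := by
  have h34 := three_quarters_lt_alphaBar.trans hα
  have hden : 0 < 4 - 4 * α ^ 2 + 3 * α := by nlinarith
  have h2 : 2 * α * (α + 1) / (4 - 4 * α ^ 2 + 3 * α) ≤ 3 / 2 := by
    rw [div_le_iff₀ hden]
    nlinarith
  unfold zeta
  split_ifs
  · exact h2
  · exact (min_le_right _ _).trans h2

theorem pow_three_le_zeta {α : ℝ} (hα : alphaBar < α) (hα1 : α ≤ 1) (t : ℝ) :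
    |t| ^ 3 ≤ 1 + |t| ^ (zeta α / (zeta α - 1)) := by
  have h1 := one_lt_zeta hα hα1
  have h2 := zeta_le hα hα1
  have h3 : 3 ≤ zeta α / (zeta α - 1) := by
    rw [le_div_iff₀ (by linarith)]
    linarith
  have h4 : 0 ≤ |t| ^ (zeta α / (zeta α - 1)) := by positivity
  rcases le_total |t| 1 with h | h
  · have := pow_le_one₀ (abs_nonneg t) h (n := 3)
    linarith
  · have := Real.rpow_le_rpow_of_exponent_le h h3
    rw [show (3 : ℝ) = ((3 : ℕ) : ℝ) by norm_num, Real.rpow_natCast] at this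
    linarith

end Exponents

end BirkhoffGibbs

end

theorem proposition6p2 (α σ : ℝ) (hα : BirkhoffGibbs.alphaBar < α) (hα1 : α ≤ 1)
    (hσ : σ = 1 ∨ σ = -1) :
    ∃ c : ℝ, 0 < c ∧ ∀ R : ℝ, 0 < R → ∀ ε : ℝ, 0 < ε → ∃ C : ℝ, 0 < C ∧
      ∀ (N : ℕ) (t : ℝ) (A : Set BirkhoffGibbs.L2), MeasurableSet A →
        BirkhoffGibbs.gibbs α σ R (BirkhoffGibbs.flow α σ N t '' A) ≤
          ENNReal.ofReal c * BirkhoffGibbs.gibbs α σ R A ^ (1 - ε) *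
            ENNReal.ofReal (Real.exp (C * (1 + |t| ^
              (BirkhoffGibbs.zeta α / (BirkhoffGibbs.zeta α - 1))))) := by
  have h34 := BirkhoffGibbs.three_quarters_lt_alphaBar.trans hα
  have hσ1 : |σ| ≤ 1 := by rcases hσ with rfl | rfl <;> simp
  refine ⟨1, one_pos, fun R hR ε hε => ?_⟩
  obtain ⟨C, hC, h⟩ := BirkhoffGibbs.exists_gibbs_image_flow_le h34 hσ1 hR hε
  refine ⟨2 * C + 1, by positivity, fun N t A hA => (h N t A hA).trans ?_⟩
  rw [ENNReal.ofReal_one, one_mul]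
  refine mul_le_mul_right (BirkhoffGibbs.ofReal_exp_mono ?_) _
  have h1 := BirkhoffGibbs.pow_three_le_zeta hα hα1 t
  have h2 : 0 ≤ |t| ^ (BirkhoffGibbs.zeta α / (BirkhoffGibbs.zeta α - 1)) := by positivity
  have h3 := mul_le_mul_of_nonneg_left h1 hC
  nlinarith
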